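/- **Setting.** A refining sequence of partitions of $[0,\infty)$ is a sequence of sets $\mathbb T_n=\{0=t^n_0<t^n_1<\cdots\}$ with $t^n_k\to\infty$ as $k\to\infty$, $\mathbb T_n\subset\mathbb T_{n+1}$, and mesh $\sup_k(t^n_{k+1}-t^n_k)\to0$ as $n\to\infty$. Fix such a sequence, and let $s'$ denote the successor of $s$ in $\mathbb T_n$. A continuous $X:[0,\infty)\to\mathbb R$ belongs to $QV$ if $\langle X\rangle_t=\lim_n\sum_{s\in\mathbb T_n,\,s'\le t}(X_{s'}-X_s)^2$ exists for every $t\ge0$ and is continuous in $t$. A continuous $X=(X^1,\dots,X^d):[0,\infty)\to\mathbb R^d$ belongs to $QV^d$ if $X^i+X^j\in QV$ for all $i,j$. A function $\xi:[0,\infty)\to\mathbb R^d$ is an admissible integrand for $X\in QV^d$ if for each $T>0$ there are $m\in\mathbb N$, open sets $U\subset\mathbb R^d$ and $W\subset\mathbb R^m$, a function $f:U\times W\to\mathbb R$, $(x,a)\mapsto f(x,a)$, that is continuously differentiable in $(x,a)$ and twice continuously differentiable in $x$ (with second $x$-derivatives continuous in $(x,a)$), and a continuous $A:[0,T]\to W$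 of bounded variation, such that $X_t\in U$ and $\xi_t=\nabla_xf(X_t,A_t)$ for $0\le t\le T$. The Föllmer integral is $$\int_0^t\xi_s\,dX_s=\lim_n\sum_{s\in\mathbb T_n,\,s'\le t}\xi_s\cdot(X_{s'}-X_s).$$ The Doléans–Dade exponential of $X\in QV$ is $\mathcal E(X)_t=\exp(X_t-\tfrac12\langle X\rangle_t)$. The Itô logarithm of a positive $Y\in QV$ is $\mathscr L(Y)_t=\log Y_t+\tfrac12\langle\log Y\rangle_t$. Let $S=(S^1,\dots,S^d)\in QV^d$ with $S^i_t>0$ for all $i$ and $t$ (the price trajectories), put $\mathscr L(S)=(\mathscr L(S^1),\dots,\mathscr L(S^d))$, and let $\Delta=\{x\in\mathbb R^d: x^i\ge0,\ \sum_ix^i=1\}$. A portfolio strategy is a function $\pi:[0,\infty)\to\Delta$ that is an admissible integrand for $\mathscr L(S)$. Its portfolio value process is $V^\pi_t=\mathcal E\big(\int_0^\cdot\pi_s\,d\mathscr L(S)_s\big)_t$. Each $\pi\in\Delta$ is identified with the strategy that is constantly equal to $\pi$ (a constant rebalanced portfolio strategy). **Theorem 3.1.** Let $\mu$ be a Borel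 probability measure on $\Delta$. Then $\log S^i\in QV$ for every $i$, and every constant $\pi\in\Delta$ is a portfolio strategy with a well-defined value process $V^\pi$. For every $t\ge0$, the functions $\pi\mapsto V^\pi_t$ and $\pi\mapsto\pi V^\pi_t$ are $\mu$-integrable on $\Delta$, and $$\widehat V_t:=\int_\Delta V^\pi_t\,\mu(d\pi)>0 .$$ Moreover, $$\widehat\pi_t:=\frac{\int_\Delta\pi V^\pi_t\,\mu(d\pi)}{\widehat V_t},\qquad t\ge0,$$ is a portfolio strategy. Its portfolio value process is well defined, that is, the Föllmer integrals $\int_0^t\widehat\pi_s\,d\mathscr L(S)_s$ exist for all $t\ge0$ and form a path in $QV$, and it satisfies $$V^{\widehat\pi}_t=\widehat V_t\qquad\text{for all }t\ge0.$$ The strategy $\widehat\pi$ is called the universal portfolio strategy. -/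

import Mathlib

open Filter Topology MeasureTheory
open scoped NNReal

noncomputable section

namespace PathwiseIto

/-- A refining sequence of partitions of `[0,∞)`. The `n`-th partition is the set
`{pt n 0 < pt n 1 < ...}`, with `pt n 0 = 0` and `pt n k → ∞` as `k → ∞`; the partitions are
increasing in `n` (as sets) and the mesh tends to `0`. The mesh is measured in `[0,∞]`, as it may
be infinite for finitely many `n`. -/
structure RefiningPartitions where
  pt : ℕ → ℕ → ℝ≥0
  pt_zero : ∀ n, pt n 0 = 0
  strictMono : ∀ n, StrictMono (pt n)
  tendsto_atTop : ∀ n, Tendsto (pt n) atTop atTop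
  refining : ∀ n, Set.range (pt n) ⊆ Set.range (pt (n + 1))
  mesh_tendsto : Tendsto (fun n => ⨆ k, edist (pt n k) (pt n (k + 1))) atTop (𝓝 0)

theorem RefiningPartitions.finite_steps (P : RefiningPartitions) (n : ℕ) (t : ℝ≥0) :
    {k : ℕ | P.pt n (k + 1) ≤ t}.Finite := by
  obtain ⟨N, hN⟩ := eventually_atTop.1 ((P.tendsto_atTop n).eventually_gt_atTop t)
  refine (Set.finite_lt_nat N).subset fun k hk => ?_
  by_contra h
  exact absurd (show P.pt n (k + 1) ≤ t from hk)
    (not_le.2 (hN (k + 1) ((not_lt.1 h).trans (Nat.le_succ k))))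

/-- Indices `k` of the points `s = pt n k` of the `n`-th partition whose successor
`s' = pt n (k + 1)` satisfies `s' ≤ t`. -/
def RefiningPartitions.steps (P : RefiningPartitions) (n : ℕ) (t : ℝ≥0) : Finset ℕ :=
  (P.finite_steps n t).toFinset

/-- `∑ (X_{s'} - X_s)²` over the points `s` of the `n`-th partition with `s' ≤ t`. -/
def qvSum (P : RefiningPartitions) (X : ℝ≥0 → ℝ) (n : ℕ) (t : ℝ≥0) : ℝ :=
  ∑ k ∈ P.steps n t, (X (P.pt n (k + 1)) - X (P.pt n k)) ^ 2

/-- The quadratic variation `⟨X⟩_t` (meaningful where the limit exists, see `InQV`). -/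
def quadVar (P : RefiningPartitions) (X : ℝ≥0 → ℝ) (t : ℝ≥0) : ℝ :=
  limUnder atTop fun n => qvSum P X n t

/-- `X ∈ QV`: `X` is continuous and admits a continuous quadratic variation along `P`. -/
structure InQV (P : RefiningPartitions) (X : ℝ≥0 → ℝ) : Prop where
  continuous : Continuous X
  exists_limit : ∀ t, ∃ q : ℝ, Tendsto (fun n => qvSum P X n t) atTop (𝓝 q)
  continuous_quadVar : Continuous (quadVar P X)

/-- `X ∈ QV^d`: `X` is continuous and `X^i + X^j ∈ QV` for all `i, j`. -/
structure InQVd (P : RefiningPartitions) {d : ℕ} (X : ℝ≥0 → Fin d → ℝ) : Prop where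
  continuous : Continuous X
  add_mem : ∀ i j, InQV P fun t => X t i + X t j

/-- `f ∈ C^{2,1}(U, W)`, for open `U`, `W`: the function `f x a` is continuously differentiable in
`(x, a) ∈ U × W` and twice continuously differentiable in `x`, with second derivatives in `x` that
are continuous in `(x, a)`. -/
structure IsC21On {d m : ℕ} (f : (Fin d → ℝ) → (Fin m → ℝ) → ℝ)
    (U : Set (Fin d → ℝ)) (W : Set (Fin m → ℝ)) : Prop where
  contDiffOn_one : ContDiffOn ℝ 1 (fun p : (Fin d → ℝ) × (Fin m → ℝ) => f p.1 p.2) (U ×ˢ W)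
  contDiffOn_two : ∀ a ∈ W, ContDiffOn ℝ 2 (fun x => f x a) U
  continuousOn_second : ContinuousOn
    (fun p : (Fin d → ℝ) × (Fin m → ℝ) => iteratedFDeriv ℝ 2 (fun x => f x p.2) p.1) (U ×ˢ W)

/-- The gradient `∇_x f(x, a) = (f_{x^1}, ..., f_{x^d})`. -/
def gradX {d m : ℕ} (f : (Fin d → ℝ) → (Fin m → ℝ) → ℝ) (x : Fin d → ℝ) (a : Fin m → ℝ) :
    Fin d → ℝ :=
  fun i => fderiv ℝ (fun y => f y a) x (Pi.single i 1)

/-- `A ∈ CBV([0,T], W)`: on `[0,T]`, `A` is continuous, of bounded variation and `W`-valued. -/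
structure IsCBVOn {m : ℕ} (A : ℝ≥0 → Fin m → ℝ) (T : ℝ≥0) (W : Set (Fin m → ℝ)) : Prop where
  continuousOn : ContinuousOn A (Set.Icc 0 T)
  boundedVariationOn : BoundedVariationOn A (Set.Icc 0 T)
  mem : ∀ t ∈ Set.Icc 0 T, A t ∈ W

/-- `ξ` is an admissible integrand for `X ∈ QV^d`. -/
structure IsAdmissibleIntegrand (P : RefiningPartitions) {d : ℕ} (X ξ : ℝ≥0 → Fin d → ℝ) :
    Prop where
  inQVd : InQVd P X
  exists_gradient : ∀ T : ℝ≥0, 0 < T →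
    ∃ (m : ℕ) (U : Set (Fin d → ℝ)) (W : Set (Fin m → ℝ))
      (f : (Fin d → ℝ) → (Fin m → ℝ) → ℝ) (A : ℝ≥0 → Fin m → ℝ),
      IsOpen U ∧ IsOpen W ∧ IsC21On f U W ∧ IsCBVOn A T W ∧
        ∀ t ∈ Set.Icc 0 T, X t ∈ U ∧ ξ t = gradX f (X t) (A t)

/-- The nonanticipative Riemann sum `∑ ξ_s · (X_{s'} - X_s)` over the points `s` of the `n`-th
partition with `s' ≤ t`. -/
def follmerSum (P : RefiningPartitions) {d : ℕ} (ξ X : ℝ≥0 → Fin d → ℝ) (n : ℕ) (t : ℝ≥0) : ℝ :=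
  ∑ k ∈ P.steps n t, ∑ i, ξ (P.pt n k) i * (X (P.pt n (k + 1)) i - X (P.pt n k) i)

/-- The Föllmer integral `∫_0^t ξ_s dX_s` (meaningful where the limit exists). -/
def follmerIntegral (P : RefiningPartitions) {d : ℕ} (ξ X : ℝ≥0 → Fin d → ℝ) (t : ℝ≥0) : ℝ :=
  limUnder atTop fun n => follmerSum P ξ X n t

/-- The Doléans–Dade exponential `ℰ(X)_t = exp(X_t - ⟨X⟩_t / 2)`, for `X ∈ QV`. -/
def ddExp (P : RefiningPartitions) (X : ℝ≥0 → ℝ) (t : ℝ≥0) : ℝ :=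
  Real.exp (X t - 1 / 2 * quadVar P X t)

/-- The Itô logarithm `ℒ(Y)_t = log Y_t + ⟨log Y⟩_t / 2`, for positive `Y ∈ QV`. -/
def itoLog (P : RefiningPartitions) (Y : ℝ≥0 → ℝ) (t : ℝ≥0) : ℝ :=
  Real.log (Y t) + 1 / 2 * quadVar P (fun s => Real.log (Y s)) t

/-- The componentwise Itô logarithm `ℒ(S) = (ℒ(S^1), ..., ℒ(S^d))`. -/
def itoLogVec (P : RefiningPartitions) {d : ℕ} (S : ℝ≥0 → Fin d → ℝ) : ℝ≥0 → Fin d → ℝ :=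
  fun t i => itoLog P (fun s => S s i) t

/-- A portfolio strategy: a `Δ`-valued admissible integrand for `ℒ(S)`. -/
structure IsPortfolioStrategy (P : RefiningPartitions) {d : ℕ} (S π : ℝ≥0 → Fin d → ℝ) :
    Prop where
  mem_simplex : ∀ t, π t ∈ stdSimplex ℝ (Fin d)
  admissible : IsAdmissibleIntegrand P (itoLogVec P S) π

/-- The portfolio value process of `π` is well defined: the Riemann sums for `∫_0^t π_s dℒ(S)_s`
converge for every `t`, and the resulting integral process belongs to `QV`. -/
structure ValueProcessExists (P : RefiningPartitions) {d : ℕ} (S π : ℝ≥0 → Fin d → ℝ) :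
    Prop where
  exists_integral : ∀ t, ∃ I : ℝ,
    Tendsto (fun n => follmerSum P π (itoLogVec P S) n t) atTop (𝓝 I)
  integral_inQV : InQV P (follmerIntegral P π (itoLogVec P S))

/-- The portfolio value process `V^π_t = ℰ(∫_0^· π_s dℒ(S)_s)_t`. -/
def portfolioValue (P : RefiningPartitions) {d : ℕ} (S π : ℝ≥0 → Fin d → ℝ) (t : ℝ≥0) : ℝ :=
  ddExp P (follmerIntegral P π (itoLogVec P S)) t

/-- The constant rebalanced portfolio strategy with weights `π ∈ Δ`. -/
def constRebalanced {d : ℕ} (π : stdSimplex ℝ (Fin d)) : ℝ≥0 → Fin d → ℝ :=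
  fun _ => (π : Fin d → ℝ)

/-- The average `V̂_t = ∫_Δ V^π_t μ(dπ)` of the values of the constant rebalanced strategies. -/
def averageValue (P : RefiningPartitions) {d : ℕ} (S : ℝ≥0 → Fin d → ℝ)
    (μ : Measure (stdSimplex ℝ (Fin d))) (t : ℝ≥0) : ℝ :=
  ∫ π, portfolioValue P S (constRebalanced π) t ∂μ

/-- The universal portfolio `π̂_t = (∫_Δ π V^π_t μ(dπ)) / V̂_t`. -/
def universalPortfolio (P : RefiningPartitions) {d : ℕ} (S : ℝ≥0 → Fin d → ℝ)
    (μ : Measure (stdSimplex ℝ (Fin d))) : ℝ≥0 → Fin d → ℝ :=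
  fun t i =>
    (∫ π, (π : Fin d → ℝ) i * portfolioValue P S (constRebalanced π) t ∂μ) / averageValue P S μ t

end PathwiseIto

end

open PathwiseIto

/-! Write X = ℒ(S). For constant π the Föllmer integral telescopes, so V^π_t = exp(L_t(π)) with
L_t(π) = π·(X_t − X_0) − ½ ∑ π_i π_j ⟨X^i,X^j⟩_t (`logValue`), a continuous path in the Banach space
C(Δ). Hence V̂ = exp Z with Z = Λ(L), where Λ(g) = log ∫ exp g dμ (`logPartition`). The derivative
of Λ at g is the mean under the tilted measure dμ_g ∝ exp(g) dμ, so π̂_t is the mean of π under μ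
tilted by L_t. It is also the x-gradient of a smooth function of X_t and the brackets, and the
brackets have bounded variation: this is admissibility.

The value identity does not pass through a general Itô formula. A step from s to s' changes Λ(L) by
the log-partition of a small function under the tilted measure at s (`logPartition_add_sub`). The
second order cumulant expansion then gives (`inc_logPartition_sub_isLittleO`) dZ = π̂·dX + ½ ∑ M_ij
(dX^i dX^j − d⟨X^i,X^j⟩) − ½ (π̂·dX)² + o(control), with M the tilted second moments. The `control`
has bounded sums, so the remainder sums to zero. The compensated sum vanishes by
`stepSum_weighted_compensated`, and the squares converge to some B. Thus ∫ π̂ dX = Z + ½B. Its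
quadratic variation is again B (`inQV_of_inc_sub_incDot`), so its Doléans–Dade exponential is exp Z
= V̂. -/

noncomputable section

open Asymptotics

namespace PathwiseIto

/-! ### Sums over partition steps and their limits. -/

section Partitions

variable (P : RefiningPartitions)

/-- The increment of `X` over the `p.2`-th step of the `p.1`-th partition. -/
def inc (X : ℝ≥0 → ℝ) (p : ℕ × ℕ) : ℝ :=
  X (P.pt p.1 (p.2 + 1)) - X (P.pt p.1 p.2)

/-- The sum of an array over the steps of the `n`-th partition that are completed by time `t`. -/
def stepSum (g : ℕ × ℕ → ℝ) (n : ℕ) (t : ℝ≥0) : ℝ :=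
  ∑ k ∈ P.steps n t, g (n, k)

/-- The filter of steps completed by time `t`, as the index of the partition tends to infinity. -/
def stepFilter (t : ℝ≥0) : Filter (ℕ × ℕ) :=
  comap Prod.fst atTop ⊓ 𝓟 {p | P.pt p.1 (p.2 + 1) ≤ t}

variable {P}

theorem mem_steps {n k : ℕ} {t : ℝ≥0} : k ∈ P.steps n t ↔ P.pt n (k + 1) ≤ t := by
  simp [RefiningPartitions.steps]

/-- Eventuality along `stepFilter` is uniform over the steps finished by `t`; this makes the
calculus of o and O available for arrays of increments. -/
theorem eventually_stepFilter {t : ℝ≥0} {q : ℕ × ℕ → Prop} :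
    (∀ᶠ p in stepFilter P t, q p) ↔
      ∀ᶠ n in atTop, ∀ k, P.pt n (k + 1) ≤ t → q (n, k) := by
  rw [stepFilter, eventually_inf_principal, eventually_comap]
  refine eventually_congr (Eventually.of_forall fun n => ⟨fun h k hk => h (n, k) rfl hk, ?_⟩)
  rintro h ⟨_, k⟩ rfl hk
  exact h k hk

theorem eventually_stepFilter_of_forall {t : ℝ≥0} {q : ℕ × ℕ → Prop}
    (h : ∀ p : ℕ × ℕ, P.pt p.1 (p.2 + 1) ≤ t → q p) : ∀ᶠ p in stepFilter P t, q p :=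
  eventually_stepFilter.2 (Eventually.of_forall fun n _ hk => h (n, _) hk)

theorem pt_le_succ (n k : ℕ) : P.pt n k ≤ P.pt n (k + 1) :=
  (P.strictMono n).monotone (Nat.le_succ k)

/-- The completed steps form an initial segment, so sums of increments telescope to the last
partition point not after `t`. -/
theorem steps_eq_range (n : ℕ) (t : ℝ≥0) : ∃ N, P.steps n t = Finset.range N ∧
    P.pt n N ≤ t ∧ t < P.pt n (N + 1) := by
  have hex : ∃ k, t < P.pt n (k + 1) := by
    obtain ⟨N, hN⟩ := eventually_atTop.1 ((P.tendsto_atTop n).eventually_gt_atTop t)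
    exact ⟨N, hN _ (Nat.le_succ N)⟩
  classical
  refine ⟨Nat.find hex, ?_, ?_, Nat.find_spec hex⟩
  · ext k
    rw [mem_steps, Finset.mem_range]
    constructor
    · intro hk
      by_contra h
      have := (P.strictMono n).monotone (Nat.succ_le_succ (not_lt.1 h))
      exact absurd (Nat.find_spec hex) (not_lt.2 (this.trans hk))
    · exact fun hk => not_lt.1 (Nat.find_min hex hk)
  · rcases Nat.eq_zero_or_pos (Nat.find hex) with h | h
    · rw [h, P.pt_zero]; exact zero_le
    · obtain ⟨m, hm⟩ := Nat.exists_eq_succ_of_ne_zero h.ne'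
      rw [hm]
      exact not_lt.1 (Nat.find_min hex (by omega))

theorem steps_zero (n : ℕ) : P.steps n 0 = ∅ := by
  ext k
  rw [mem_steps]
  have : 0 < P.pt n (k + 1) := by
    rw [← P.pt_zero n]; exact P.strictMono n (Nat.succ_pos k)
  simp [this.ne']

theorem steps_mono (n : ℕ) {s t : ℝ≥0} (h : s ≤ t) : P.steps n s ⊆ P.steps n t := fun _ hk =>
  mem_steps.2 ((mem_steps.1 hk).trans h)

theorem eventually_dist_lt {δ : ℝ} (hδ : 0 < δ) :
    ∀ᶠ n in atTop, ∀ k, dist (P.pt n k) (P.pt n (k + 1)) < δ := by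
  have := P.mesh_tendsto.eventually_lt_const (ENNReal.ofReal_pos.2 hδ)
  filter_upwards [this] with n hn k
  have h := lt_of_le_of_lt (le_iSup (fun k => edist (P.pt n k) (P.pt n (k + 1))) k) hn
  rwa [edist_dist, ENNReal.ofReal_lt_ofReal_iff hδ] at h

theorem tendsto_inc {X : ℝ≥0 → ℝ} (hX : Continuous X) (t : ℝ≥0) :
    Tendsto (inc P X) (stepFilter P t) (𝓝 0) := by
  have hu := (isCompact_Icc (a := (0 : ℝ≥0)) (b := t)).uniformContinuousOn_of_continuous
    hX.continuousOn
  rw [Metric.tendsto_nhds]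
  intro ε hε
  obtain ⟨δ, hδ, h⟩ := Metric.uniformContinuousOn_iff.1 hu ε hε
  rw [eventually_stepFilter]
  filter_upwards [eventually_dist_lt hδ] with n hn k hk
  have := h (P.pt n (k + 1)) ⟨zero_le, hk⟩ (P.pt n k) ⟨zero_le, (pt_le_succ n k).trans hk⟩
    (by rw [dist_comm]; exact hn k)
  simpa [inc, Real.dist_eq] using this

theorem tendsto_stepSum_inc {X : ℝ≥0 → ℝ} (hX : Continuous X) (t : ℝ≥0) :
    Tendsto (fun n => stepSum P (inc P X) n t) atTop (𝓝 (X t - X 0)) := by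
  choose N hN h1 h2 using fun n => steps_eq_range (P := P) n t
  have hlim : Tendsto (fun n => P.pt n (N n)) atTop (𝓝 t) := by
    rw [Metric.tendsto_nhds]
    intro ε hε
    filter_upwards [eventually_dist_lt (P := P) hε] with n hn
    refine lt_of_le_of_lt ?_ (hn (N n))
    rw [NNReal.dist_eq, NNReal.dist_eq]
    have a := NNReal.coe_le_coe.2 (h1 n)
    have b := NNReal.coe_lt_coe.2 (h2 n)
    rw [abs_of_nonpos (by linarith), abs_of_nonpos (by linarith)]
    linarith
  have hs : ∀ n, stepSum P (inc P X) n t = X (P.pt n (N n)) - X 0 := by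
    intro n
    rw [stepSum, hN]
    simp only [inc]
    rw [Finset.sum_range_sub (fun k => X (P.pt n k)), P.pt_zero]
  simp only [hs]
  exact ((hX.tendsto t).comp hlim).sub_const _

theorem stepSum_zero (g : ℕ × ℕ → ℝ) (n : ℕ) : stepSum P g n 0 = 0 := by
  simp [stepSum, steps_zero]

theorem stepSum_add (f g : ℕ × ℕ → ℝ) (n : ℕ) (t : ℝ≥0) :
    stepSum P (fun p => f p + g p) n t = stepSum P f n t + stepSum P g n t :=
  Finset.sum_add_distrib

theorem stepSum_sub (f g : ℕ × ℕ → ℝ) (n : ℕ) (t : ℝ≥0) :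
    stepSum P (fun p => f p - g p) n t = stepSum P f n t - stepSum P g n t :=
  Finset.sum_sub_distrib _ _

theorem stepSum_const_mul (c : ℝ) (g : ℕ × ℕ → ℝ) (n : ℕ) (t : ℝ≥0) :
    stepSum P (fun p => c * g p) n t = c * stepSum P g n t :=
  (Finset.mul_sum _ _ _).symm

theorem stepSum_sum {ι : Type*} (s : Finset ι) (g : ι → ℕ × ℕ → ℝ) (n : ℕ) (t : ℝ≥0) :
    stepSum P (fun p => ∑ i ∈ s, g i p) n t = ∑ i ∈ s, stepSum P (g i) n t :=
  Finset.sum_comm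

theorem abs_stepSum_le {f g : ℕ × ℕ → ℝ} {n : ℕ} {t : ℝ≥0}
    (h : ∀ k, P.pt n (k + 1) ≤ t → |f (n, k)| ≤ g (n, k)) :
    |stepSum P f n t| ≤ stepSum P g n t :=
  (Finset.abs_sum_le_sum_abs _ _).trans (Finset.sum_le_sum fun k hk => h k (mem_steps.1 hk))

theorem abs_stepSum_sub_le {f g : ℕ × ℕ → ℝ} {n : ℕ} {s t : ℝ≥0} (hst : s ≤ t)
    (h : ∀ k, s < P.pt n (k + 1) → P.pt n (k + 1) ≤ t → |f (n, k)| ≤ g (n, k)) :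
    |stepSum P f n t - stepSum P f n s| ≤ stepSum P g n t - stepSum P g n s := by
  have hd : ∀ f, stepSum P f n t - stepSum P f n s =
      ∑ k ∈ P.steps n t \ P.steps n s, f (n, k) := fun f => by
    rw [stepSum, stepSum, ← Finset.sum_sdiff (steps_mono n hst)]; ring
  rw [hd, hd]
  refine (Finset.abs_sum_le_sum_abs _ _).trans (Finset.sum_le_sum fun k hk => ?_)
  rw [Finset.mem_sdiff, mem_steps, mem_steps, not_le] at hk
  exact h k hk.2 hk.1

/-- An array that is negligible with respect to one with bounded sums has vanishing sums. -/
theorem tendsto_stepSum_of_isLittleO {r κ : ℕ × ℕ → ℝ} {t : ℝ≥0} {B : ℝ}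
    (hr : r =o[stepFilter P t] κ) (hB : ∀ᶠ n in atTop, stepSum P (fun p => |κ p|) n t ≤ B) :
    Tendsto (fun n => stepSum P r n t) atTop (𝓝 0) := by
  rw [Metric.tendsto_nhds]
  intro ε hε
  have hc : 0 < ε / (|B| + 1) := by positivity
  have := eventually_stepFilter.1 (hr.def hc)
  filter_upwards [this, hB] with n h1 h2
  rw [Real.dist_eq, sub_zero]
  calc |stepSum P r n t| ≤ stepSum P (fun p => ε / (|B| + 1) * |κ p|) n t := abs_stepSum_le h1
    _ = ε / (|B| + 1) * stepSum P (fun p => |κ p|) n t := stepSum_const_mul ..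
    _ ≤ ε / (|B| + 1) * |B| := by gcongr; exact h2.trans (le_abs_self B)
    _ < ε := by rw [div_mul_eq_mul_div, div_lt_iff₀ (by positivity)]; nlinarith

/-- Freeze `h` at coarse grid points: a step is assigned to the cell `(τ j, τ (j + 1)]` in which it
ends, and each replacement costs at most `ε` times the absolute value of `g`. -/
theorem abs_sum_sub_le_of_grid {h : ℝ≥0 → ℝ} {g : ℕ × ℕ → ℝ} {n : ℕ} {ε : ℝ} {τ : ℕ → ℝ≥0}
    (hτ0 : τ 0 = 0) (hτ : Monotone τ) (N : ℕ)
    (hh : ∀ j < N, ∀ k, τ j < P.pt n (k + 1) → P.pt n (k + 1) ≤ τ (j + 1) →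
      |h (P.pt n k) - h (τ j)| ≤ ε) :
    |stepSum P (fun p => h (P.pt p.1 p.2) * g p) n (τ N) -
        ∑ j ∈ Finset.range N, h (τ j) * (stepSum P g n (τ (j + 1)) - stepSum P g n (τ j))| ≤
      ε * stepSum P (fun p => |g p|) n (τ N) := by
  induction N with
  | zero => simp [hτ0, stepSum_zero]
  | succ N ih =>
    have ih := ih fun j hj => hh j (by omega)
    have h1 := abs_stepSum_sub_le (f := fun p => h (P.pt p.1 p.2) * g p - h (τ N) * g p)
      (g := fun p => ε * |g p|) (n := n) (hτ (Nat.le_succ N)) (fun k h1 h2 => by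
        rw [← sub_mul, abs_mul]
        gcongr
        exact hh N (Nat.lt_succ_self N) k h1 h2)
    rw [stepSum_sub, stepSum_sub, stepSum_const_mul, stepSum_const_mul, stepSum_const_mul,
      stepSum_const_mul] at h1
    rw [Finset.sum_range_succ]
    rw [abs_le] at *
    simp only [Nat.succ_eq_add_one] at *
    constructor <;> linarith [h1.1, h1.2, ih.1, ih.2]

theorem exists_grid_approx {h : ℝ≥0 → ℝ} (hh : Continuous h) (g : ℕ × ℕ → ℝ) (t : ℝ≥0)
    {ε : ℝ} (hε : 0 < ε) :
    ∃ (N : ℕ) (τ : ℕ → ℝ≥0), ∀ᶠ n in atTop,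
      |stepSum P (fun p => h (P.pt p.1 p.2) * g p) n t -
        ∑ j ∈ Finset.range N, h (τ j) * (stepSum P g n (τ (j + 1)) - stepSum P g n (τ j))| ≤
      ε * stepSum P (fun p => |g p|) n t := by
  have hu := (isCompact_Icc (a := (0 : ℝ≥0)) (b := t)).uniformContinuousOn_of_continuous
    hh.continuousOn
  obtain ⟨δ, hδ, hu⟩ := Metric.uniformContinuousOn_iff.1 hu ε hε
  obtain ⟨N, hN⟩ := exists_nat_gt ((t : ℝ) / (δ / 2))
  have hN0 : (0 : ℝ) < N := lt_of_le_of_lt (by positivity) hN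
  have hN' : N ≠ 0 := by exact_mod_cast hN0.ne'
  let τ : ℕ → ℝ≥0 := fun j => t * (j / N)
  have hτN : τ N = t := by
    simp only [τ]; rw [div_self (by exact_mod_cast hN'), mul_one]
  have hτmono : Monotone τ := fun i j hij => by
    simp only [τ]; gcongr
  refine ⟨N, τ, ?_⟩
  filter_upwards [eventually_dist_lt (P := P) (half_pos hδ)] with n hn
  have := abs_sum_sub_le_of_grid (P := P) (h := h) (g := g) (n := n) (ε := ε) (τ := τ)
    (by simp [τ]) hτmono N (fun j hj k h1 h2 => by
      have h2t : P.pt n (k + 1) ≤ t := h2.trans (hτN ▸ hτmono (Nat.succ_le_of_lt hj))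
      refine (hu (P.pt n k) ⟨zero_le, (pt_le_succ n k).trans h2t⟩ (τ j)
        ⟨zero_le, h1.le.trans h2t⟩ ?_).le
      -- The left end of the step is within `δ / 2` of its right end (mesh), which is within `t / N
      -- < δ / 2` of `τ j` (cell width).
      refine (dist_triangle _ (P.pt n (k + 1)) _).trans_lt ?_
      have h3 : dist (P.pt n (k + 1)) (τ j) ≤ t / N := by
        have e : (τ (j + 1) : ℝ) = τ j + t / N := by
          simp only [τ]; push_cast; ring
        have a := NNReal.coe_le_coe.2 h2
        have b := NNReal.coe_lt_coe.2 h1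
        rw [NNReal.dist_eq, abs_of_nonneg (by linarith)]
        linarith
      have h4 : (t : ℝ) / N < δ / 2 := by
        rw [div_lt_iff₀ (half_pos hδ)] at hN
        rw [div_lt_iff₀ hN0]; linarith
      linarith [hn k])
  rwa [hτN] at this

/-- Sums of an array with convergent, absolutely bounded sums also converge after weighting by a
continuous function evaluated at the left end points. -/
theorem exists_tendsto_stepSum_mul {h : ℝ≥0 → ℝ} (hh : Continuous h) {g : ℕ × ℕ → ℝ} {t : ℝ≥0}
    {G : ℝ≥0 → ℝ} (hG : ∀ s, Tendsto (fun n => stepSum P g n s) atTop (𝓝 (G s))) {B : ℝ}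
    (hB : ∀ᶠ n in atTop, stepSum P (fun p => |g p|) n t ≤ B) :
    ∃ L, Tendsto (fun n => stepSum P (fun p => h (P.pt p.1 p.2) * g p) n t) atTop (𝓝 L) ∧
      ((∀ s, G s = 0) → L = 0) := by
  -- On a fixed coarse grid the frozen sums converge as `n → ∞`, so the weighted sums are eventually
  -- `ε`-close to a single number, which is zero if `G` vanishes. This yields the Cauchy property
  -- and the value of the limit.
  have key : ∀ ε > 0, ∃ l, ((∀ s, G s = 0) → l = 0) ∧ ∀ᶠ n in atTop,
      |stepSum P (fun p => h (P.pt p.1 p.2) * g p) n t - l| < ε := by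
    intro ε hε
    obtain ⟨N, τ, happ⟩ := exists_grid_approx (P := P) hh g t
      (ε := ε / 2 / (|B| + 1)) (by positivity)
    refine ⟨∑ j ∈ Finset.range N, h (τ j) * (G (τ (j + 1)) - G (τ j)),
      fun h0 => by simp [h0], ?_⟩
    have hlim : Tendsto (fun n => ∑ j ∈ Finset.range N,
        h (τ j) * (stepSum P g n (τ (j + 1)) - stepSum P g n (τ j))) atTop
        (𝓝 (∑ j ∈ Finset.range N, h (τ j) * (G (τ (j + 1)) - G (τ j)))) :=
      tendsto_finsetSum _ fun j _ => ((hG _).sub (hG _)).const_mul _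
    filter_upwards [happ, hB, (Metric.tendsto_nhds.1 hlim) (ε / 2) (half_pos hε)] with n h1 h2 h3
    rw [Real.dist_eq] at h3
    have h4 : ε / 2 / (|B| + 1) * stepSum P (fun p => |g p|) n t ≤ ε / 2 := by
      rw [div_mul_eq_mul_div, div_le_iff₀ (by positivity)]
      have := h2.trans (le_abs_self B)
      nlinarith
    have h5 := abs_le.1 (h1.trans h4)
    rw [abs_lt] at h3 ⊢
    constructor <;> linarith [h3.1, h3.2, h5.1, h5.2]
  have hc : CauchySeq fun n => stepSum P (fun p => h (P.pt p.1 p.2) * g p) n t := by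
    rw [Metric.cauchySeq_iff']
    intro ε hε
    obtain ⟨l, -, hl⟩ := key (ε / 2) (half_pos hε)
    obtain ⟨N, hN⟩ := eventually_atTop.1 hl
    refine ⟨N, fun n hn => ?_⟩
    refine (dist_triangle_right _ _ l).trans_lt ?_
    rw [Real.dist_eq, Real.dist_eq]
    linarith [hN n hn, hN N le_rfl]
  obtain ⟨L, hL⟩ := cauchySeq_tendsto_of_complete hc
  refine ⟨L, hL, fun h0 => ?_⟩
  refine tendsto_nhds_unique hL (Metric.tendsto_nhds.2 fun ε hε => ?_)
  obtain ⟨l, hl0, hl⟩ := key ε hε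
  rw [hl0 h0] at hl
  simpa only [Real.dist_eq] using hl

end Partitions

/-! ### Quadratic variation of a single path. -/

section QuadVar

variable {P : RefiningPartitions}

theorem tendsto_quadVar {X : ℝ≥0 → ℝ} (hX : InQV P X) (t : ℝ≥0) :
    Tendsto (fun n => stepSum P (fun p => inc P X p ^ 2) n t) atTop (𝓝 (quadVar P X t)) :=
  tendsto_nhds_limUnder (hX.exists_limit t)

theorem quadVar_eq_of_tendsto {X : ℝ≥0 → ℝ} {t : ℝ≥0} {q : ℝ}
    (h : Tendsto (fun n => stepSum P (fun p => inc P X p ^ 2) n t) atTop (𝓝 q)) :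
    quadVar P X t = q :=
  h.limUnder_eq

theorem quadVar_zero (X : ℝ≥0 → ℝ) : quadVar P X 0 = 0 :=
  quadVar_eq_of_tendsto (by simp [stepSum_zero])

theorem inQV_of_tendsto {X q : ℝ≥0 → ℝ} (hX : Continuous X) (hq : Continuous q)
    (h : ∀ t, Tendsto (fun n => stepSum P (fun p => inc P X p ^ 2) n t) atTop (𝓝 (q t))) :
    InQV P X :=
  ⟨hX, fun t => ⟨q t, h t⟩, by rwa [show quadVar P X = q from funext fun t =>
    quadVar_eq_of_tendsto (h t)]⟩

theorem inc_add (X Y : ℝ≥0 → ℝ) (p : ℕ × ℕ) :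
    inc P (fun t => X t + Y t) p = inc P X p + inc P Y p := by
  simp only [inc]; ring

theorem InQVd.inQV {d : ℕ} {X : ℝ≥0 → Fin d → ℝ} (hX : InQVd P X) (i : Fin d) :
    InQV P fun t => X t i := by
  have h := hX.add_mem i i
  refine inQV_of_tendsto ((continuous_apply i).comp hX.continuous)
    -- The membership hypothesis with `j = i` concerns twice the component, hence the factor 1/4.
    (h.continuous_quadVar.const_mul (1 / 4)) fun t => ?_
  refine ((tendsto_quadVar h t).const_mul (1 / 4)).congr fun n => ?_
  rw [← stepSum_const_mul]
  congr 1
  funext p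
  rw [inc_add]
  ring

end QuadVar

/-! ### Covariations and the size of increments. -/

section Brackets

variable (P : RefiningPartitions) {d : ℕ} (X : ℝ≥0 → Fin d → ℝ)

/-- The covariation `⟨X^i, X^j⟩`, defined by polarization. -/
def bracket (i j : Fin d) (t : ℝ≥0) : ℝ :=
  1 / 2 * (quadVar P (fun t => X t i + X t j) t - quadVar P (fun t => X t i) t -
    quadVar P (fun t => X t j) t)

/-- The sum of the quadratic variations of the components. -/
def totalVar (t : ℝ≥0) : ℝ :=
  ∑ i, quadVar P (fun t => X t i) t

/-- The sum of the squared increments of the components. -/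
def energy (p : ℕ × ℕ) : ℝ :=
  ∑ i, inc P (fun t => X t i) p ^ 2

/-- The array against which remainders are measured. -/
def control (p : ℕ × ℕ) : ℝ :=
  energy P X p + inc P (totalVar P X) p

variable {P X}

theorem energy_nonneg (p : ℕ × ℕ) : 0 ≤ energy P X p :=
  Finset.sum_nonneg fun _ _ => sq_nonneg _

theorem sq_inc_le_energy (i : Fin d) (p : ℕ × ℕ) :
    inc P (fun t => X t i) p ^ 2 ≤ energy P X p :=
  Finset.single_le_sum (f := fun i => inc P (fun t => X t i) p ^ 2) (fun _ _ => sq_nonneg _)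
    (Finset.mem_univ i)

theorem abs_inc_mul_inc_le (i j : Fin d) (p : ℕ × ℕ) :
    |inc P (fun t => X t i) p * inc P (fun t => X t j) p| ≤ energy P X p := by
  have h1 := sq_inc_le_energy (P := P) (X := X) i p
  have h2 := sq_inc_le_energy (P := P) (X := X) j p
  rw [abs_le]
  constructor <;> nlinarith [sq_nonneg (inc P (fun t => X t i) p + inc P (fun t => X t j) p),
    sq_nonneg (inc P (fun t => X t i) p - inc P (fun t => X t j) p)]

theorem InQVd.tendsto_bracket (hX : InQVd P X) (i j : Fin d) (t : ℝ≥0) :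
    Tendsto (fun n => stepSum P
      (fun p => inc P (fun t => X t i) p * inc P (fun t => X t j) p) n t) atTop
      (𝓝 (bracket P X i j t)) := by
  refine ((((tendsto_quadVar (hX.add_mem i j) t).sub (tendsto_quadVar (hX.inQV i) t)).sub
    (tendsto_quadVar (hX.inQV j) t)).const_mul (1 / 2)).congr fun n => ?_
  rw [← stepSum_sub, ← stepSum_sub, ← stepSum_const_mul]
  congr 1
  funext p
  rw [inc_add]
  ring

theorem InQVd.continuous_bracket (hX : InQVd P X) (i j : Fin d) :
    Continuous (bracket P X i j) :=
  (((hX.add_mem i j).continuous_quadVar.sub (hX.inQV i).continuous_quadVar).sub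
    (hX.inQV j).continuous_quadVar).const_mul _

theorem bracket_zero (i j : Fin d) : bracket P X i j 0 = 0 := by
  simp [bracket, quadVar_zero]

theorem InQVd.continuous_totalVar (hX : InQVd P X) : Continuous (totalVar P X) :=
  continuous_finsetSum _ fun i _ => (hX.inQV i).continuous_quadVar

theorem InQVd.tendsto_energy (hX : InQVd P X) (t : ℝ≥0) :
    Tendsto (fun n => stepSum P (energy P X) n t) atTop (𝓝 (totalVar P X t)) := by
  refine (tendsto_finsetSum Finset.univ fun i _ => tendsto_quadVar (hX.inQV i) t).congr
    fun n => ?_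
  rw [← stepSum_sum]
  rfl

/-- Limits of sums dominated by the energy have increments dominated by the total variation. -/
theorem InQVd.abs_sub_le_totalVar (hX : InQVd P X) {g : ℕ × ℕ → ℝ} {s t : ℝ≥0} (hst : s ≤ t)
    {a b c : ℝ} (ha : Tendsto (fun n => stepSum P g n s) atTop (𝓝 a))
    (hb : Tendsto (fun n => stepSum P g n t) atTop (𝓝 b))
    (hg : ∀ p, P.pt p.1 (p.2 + 1) ≤ t → |g p| ≤ c * energy P X p) :
    |b - a| ≤ c * (totalVar P X t - totalVar P X s) := by
  refine le_of_tendsto_of_tendsto' (hb.sub ha).abs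
    (((hX.tendsto_energy t).sub (hX.tendsto_energy s)).const_mul c) fun n => ?_
  refine (abs_stepSum_sub_le (g := fun p => c * energy P X p) hst
    fun k _ hk => hg (n, k) hk).trans_eq ?_
  rw [stepSum_const_mul, stepSum_const_mul]; ring

theorem InQVd.totalVar_mono (hX : InQVd P X) : Monotone (totalVar P X) := fun s t hst => by
  have := hX.abs_sub_le_totalVar hst (hX.tendsto_energy s) (hX.tendsto_energy t)
    (c := 1) (fun p _ => by rw [abs_of_nonneg (energy_nonneg p), one_mul])
  linarith [(abs_nonneg _).trans this]

/-- Since |ab| is at most a² + b² (or a² if the indices agree), the total variation dominates every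
bracket. This serves both for bounded variation and for estimates by `control`. -/
theorem InQVd.abs_bracket_sub_le (hX : InQVd P X) (i j : Fin d) {s t : ℝ≥0} (hst : s ≤ t) :
    |bracket P X i j t - bracket P X i j s| ≤ totalVar P X t - totalVar P X s := by
  have := hX.abs_sub_le_totalVar hst (hX.tendsto_bracket i j s) (hX.tendsto_bracket i j t)
    (c := 1) (fun p _ => by rw [one_mul]; exact abs_inc_mul_inc_le i j p)
  rwa [one_mul] at this

theorem InQVd.inc_totalVar_nonneg (hX : InQVd P X) (p : ℕ × ℕ) :
    0 ≤ inc P (totalVar P X) p :=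
  sub_nonneg.2 (hX.totalVar_mono (pt_le_succ _ _))

theorem InQVd.control_nonneg (hX : InQVd P X) (p : ℕ × ℕ) : 0 ≤ control P X p :=
  add_nonneg (energy_nonneg p) (hX.inc_totalVar_nonneg p)

theorem InQVd.energy_le_control (hX : InQVd P X) (p : ℕ × ℕ) :
    energy P X p ≤ control P X p :=
  le_add_of_nonneg_right (hX.inc_totalVar_nonneg p)

theorem inc_totalVar_le_control (p : ℕ × ℕ) :
    inc P (totalVar P X) p ≤ control P X p :=
  le_add_of_nonneg_left (energy_nonneg p)

/-- The energy sums converge and the increments of `totalVar` telescope. -/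
theorem InQVd.stepSum_control_bounded (hX : InQVd P X) (t : ℝ≥0) :
    ∃ B, ∀ᶠ n in atTop, stepSum P (fun p => |control P X p|) n t ≤ B := by
  have h := (hX.tendsto_energy t).add (tendsto_stepSum_inc (P := P) hX.continuous_totalVar t)
  refine ⟨totalVar P X t + (totalVar P X t - totalVar P X 0) + 1,
    (h.eventually_le_const (lt_add_one _)).mono fun n hn => ?_⟩
  rw [← stepSum_add] at hn
  refine le_of_eq_of_le ?_ hn
  congr 1
  funext p
  rw [abs_of_nonneg (hX.control_nonneg p)]
  rfl

theorem InQVd.tendsto_stepSum_zero (hX : InQVd P X) {r : ℕ × ℕ → ℝ} {t : ℝ≥0}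
    (hr : r =o[stepFilter P t] control P X) :
    Tendsto (fun n => stepSum P r n t) atTop (𝓝 0) := by
  obtain ⟨B, hB⟩ := hX.stepSum_control_bounded t
  exact tendsto_stepSum_of_isLittleO hr hB

theorem InQVd.tendsto_control (hX : InQVd P X) (t : ℝ≥0) :
    Tendsto (control P X) (stepFilter P t) (𝓝 0) := by
  have h1 : Tendsto (energy P X) (stepFilter P t) (𝓝 (∑ _i : Fin d, (0 : ℝ) ^ 2)) :=
    tendsto_finsetSum _ fun i _ => (tendsto_inc (hX.inQV i).continuous t).pow 2
  have h2 := h1.add (tendsto_inc hX.continuous_totalVar t)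
  rw [show (∑ _i : Fin d, (0 : ℝ) ^ 2) + 0 = 0 by simp] at h2
  exact h2

theorem exists_bound_on_Icc {h : ℝ≥0 → ℝ} (hh : Continuous h) (T : ℝ≥0) :
    ∃ c, 0 ≤ c ∧ ∀ t ≤ T, |h t| ≤ c := by
  obtain ⟨c, hc⟩ := (isCompact_Icc (a := (0 : ℝ≥0)) (b := T)).exists_bound_of_continuousOn
    hh.continuousOn
  exact ⟨|c|, abs_nonneg c, fun t ht => (hc t ⟨zero_le, ht⟩).trans (le_abs_self c)⟩

/-- The Riemann sum increment `h_s · (X_{s'} - X_s)`. -/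
def incDot (P : RefiningPartitions) (h X : ℝ≥0 → Fin d → ℝ) (p : ℕ × ℕ) : ℝ :=
  ∑ i, h (P.pt p.1 p.2) i * inc P (fun t => X t i) p

theorem incDot_sq_eq (h : ℝ≥0 → Fin d → ℝ) (p : ℕ × ℕ) :
    incDot P h X p ^ 2 = ∑ i, ∑ j, h (P.pt p.1 p.2) i * h (P.pt p.1 p.2) j *
      (inc P (fun t => X t i) p * inc P (fun t => X t j) p) := by
  rw [sq, incDot, Finset.sum_mul_sum]
  refine Finset.sum_congr rfl fun i _ => Finset.sum_congr rfl fun j _ => ?_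
  ring

theorem incDot_sq_le {h : ℝ≥0 → Fin d → ℝ} (hh : Continuous h) (T : ℝ≥0) :
    ∃ c, 0 ≤ c ∧ ∀ p, P.pt p.1 (p.2 + 1) ≤ T → incDot P h X p ^ 2 ≤ c * energy P X p := by
  obtain ⟨c, hc0, hc⟩ := exists_bound_on_Icc
    (continuous_finsetSum Finset.univ fun i _ => ((continuous_apply i).comp hh).pow 2) T
  refine ⟨c, hc0, fun p hp => ?_⟩
  refine (Finset.sum_mul_sq_le_sq_mul_sq _ _ _).trans ?_
  exact mul_le_mul_of_nonneg_right
    ((le_abs_self _).trans (hc _ ((pt_le_succ _ _).trans hp))) (energy_nonneg p)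

theorem InQVd.stepSum_weighted (hX : InQVd P X) {h : ℝ≥0 → ℝ} (hh : Continuous h) (i j : Fin d)
    (t : ℝ≥0) : ∃ L, Tendsto (fun n => stepSum P (fun p => h (P.pt p.1 p.2) *
      (inc P (fun t => X t i) p * inc P (fun t => X t j) p)) n t) atTop (𝓝 L) := by
  obtain ⟨B, hB⟩ := hX.stepSum_control_bounded t
  obtain ⟨L, hL, -⟩ := exists_tendsto_stepSum_mul hh (t := t) (hX.tendsto_bracket i j)
    (B := B) (hB.mono fun n hn => (Finset.sum_le_sum fun k _ =>
      (abs_inc_mul_inc_le i j _).trans ((hX.energy_le_control _).trans (le_abs_self _))).trans hn)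
  exact ⟨L, hL⟩

/-- Products of increments and increments of the bracket have the same limiting sums at every time,
and their difference is dominated by `control`; a continuous weight cannot spoil this cancellation.
-/
theorem InQVd.stepSum_weighted_compensated (hX : InQVd P X) {h : ℝ≥0 → ℝ} (hh : Continuous h)
    (i j : Fin d) (t : ℝ≥0) : Tendsto (fun n => stepSum P (fun p => h (P.pt p.1 p.2) *
      (inc P (fun t => X t i) p * inc P (fun t => X t j) p - inc P (bracket P X i j) p)) n t)
      atTop (𝓝 0) := by
  obtain ⟨B, hB⟩ := hX.stepSum_control_bounded t
  obtain ⟨L, hL, hL0⟩ := exists_tendsto_stepSum_mul hh (P := P) (t := t) (G := fun _ => 0)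
    (g := fun p => inc P (fun t => X t i) p * inc P (fun t => X t j) p -
      inc P (bracket P X i j) p) (fun s => by
        have := (hX.tendsto_bracket i j s).sub
          (tendsto_stepSum_inc (P := P) (hX.continuous_bracket i j) s)
        simpa [bracket_zero, stepSum_sub] using this)
    (B := B) (hB.mono fun n hn => (Finset.sum_le_sum fun k _ =>
      ((abs_sub _ _).trans (add_le_add (abs_inc_mul_inc_le i j _)
        (hX.abs_bracket_sub_le i j (pt_le_succ _ _)))).trans (le_abs_self _)).trans hn)
  rwa [hL0 fun _ => rfl] at hL

/-- Existence of the limit `∑_{i,j} ∫ h_i h_j d⟨X^i, X^j⟩` of the sums of `(h · dX)²`. -/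
theorem InQVd.exists_tendsto_incDot_sq (hX : InQVd P X) {h : ℝ≥0 → Fin d → ℝ}
    (hh : Continuous h) :
    ∃ B : ℝ≥0 → ℝ, (∀ t, Tendsto (fun n => stepSum P (fun p => incDot P h X p ^ 2) n t) atTop
      (𝓝 (B t))) ∧ Continuous B ∧ ∀ T, ∃ c, 0 ≤ c ∧ ∀ s t, s ≤ t → t ≤ T →
        |B t - B s| ≤ c * (totalVar P X t - totalVar P X s) := by
  have hL : ∀ t i j, ∃ L, Tendsto (fun n => stepSum P (fun p => h (P.pt p.1 p.2) i *
      h (P.pt p.1 p.2) j * (inc P (fun t => X t i) p * inc P (fun t => X t j) p)) n t) atTop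
      (𝓝 L) := fun t i j => hX.stepSum_weighted
        (h := fun t => h t i * h t j) (by fun_prop) i j t
  choose L hL using hL
  have hB : ∀ t, Tendsto (fun n => stepSum P (fun p => incDot P h X p ^ 2) n t) atTop
      (𝓝 (∑ i, ∑ j, L t i j)) := fun t => by
    simp only [incDot_sq_eq, stepSum_sum]
    exact tendsto_finsetSum _ fun i _ => tendsto_finsetSum _ fun j _ => hL t i j
  have hc : ∀ T, ∃ c, 0 ≤ c ∧ ∀ s t, s ≤ t → t ≤ T →
      |(∑ i, ∑ j, L t i j) - ∑ i, ∑ j, L s i j| ≤ c * (totalVar P X t - totalVar P X s) := by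
    intro T
    obtain ⟨c, hc0, hc⟩ := incDot_sq_le (P := P) (X := X) hh T
    refine ⟨c, hc0, fun s t hst htT => hX.abs_sub_le_totalVar hst (hB s) (hB t) fun p hp => ?_⟩
    rw [abs_of_nonneg (sq_nonneg _)]
    exact hc p (hp.trans htT)
  refine ⟨fun t => ∑ i, ∑ j, L t i j, hB, ?_, hc⟩
  rw [continuous_iff_continuousAt]
  intro t
  -- The horizon `t + 1` leaves room for a two-sided neighbourhood of `t`.
  obtain ⟨c, hc0, hc⟩ := hc (t + 1)
  have hlim : Tendsto (fun s => c * |totalVar P X s - totalVar P X t|) (𝓝 t) (𝓝 0) := by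
    have := ((hX.continuous_totalVar.tendsto t).sub_const (totalVar P X t)).abs.const_mul c
    simpa using this
  refine tendsto_iff_dist_tendsto_zero.2 (squeeze_zero' (Eventually.of_forall fun _ =>
    dist_nonneg) ?_ hlim)
  filter_upwards [Iio_mem_nhds (show t < t + 1 from lt_add_one t)] with s hs
  rw [Real.dist_eq]
  rcases le_total s t with hst | hst
  · rw [abs_sub_comm]
    refine (hc s t hst (le_of_lt (lt_add_one t))).trans ?_
    rw [abs_sub_comm]
    exact mul_le_mul_of_nonneg_left (le_abs_self _) hc0
  · exact (hc t s hst (le_of_lt hs)).trans (mul_le_mul_of_nonneg_left (le_abs_self _) hc0)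

/-- The square root of the control. -/
def rootControl (P : RefiningPartitions) (X : ℝ≥0 → Fin d → ℝ) (p : ℕ × ℕ) : ℝ :=
  √(control P X p)

theorem InQVd.rootControl_mul_self (hX : InQVd P X) (p : ℕ × ℕ) :
    rootControl P X p * rootControl P X p = control P X p :=
  Real.mul_self_sqrt (hX.control_nonneg p)

theorem InQVd.tendsto_rootControl (hX : InQVd P X) (t : ℝ≥0) :
    Tendsto (rootControl P X) (stepFilter P t) (𝓝 0) := by
  rw [← Real.sqrt_zero]
  exact (hX.tendsto_control t).sqrt

theorem InQVd.control_isLittleO (hX : InQVd P X) (t : ℝ≥0) :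
    control P X =o[stepFilter P t] rootControl P X := by
  have h := ((isLittleO_one_iff ℝ).2 (hX.tendsto_rootControl t)).mul_isBigO
    (isBigO_refl (rootControl P X) (stepFilter P t))
  simpa [hX.rootControl_mul_self] using h

theorem InQVd.inc_isBigO (hX : InQVd P X) (i : Fin d) (t : ℝ≥0) :
    inc P (fun t => X t i) =O[stepFilter P t] rootControl P X := by
  refine IsBigO.of_bound 1 (Eventually.of_forall fun p => ?_)
  rw [one_mul, Real.norm_eq_abs, Real.norm_eq_abs, rootControl, abs_of_nonneg (Real.sqrt_nonneg _)]
  exact Real.abs_le_sqrt ((sq_inc_le_energy i p).trans (hX.energy_le_control p))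

theorem InQVd.incDot_isBigO (hX : InQVd P X) {h : ℝ≥0 → Fin d → ℝ} (hh : Continuous h)
    (t : ℝ≥0) : incDot P h X =O[stepFilter P t] rootControl P X := by
  obtain ⟨c, hc0, hc⟩ := incDot_sq_le (P := P) (X := X) hh t
  refine IsBigO.of_bound (√c) (eventually_stepFilter_of_forall fun p hp => ?_)
  rw [Real.norm_eq_abs, Real.norm_eq_abs, rootControl, abs_of_nonneg (Real.sqrt_nonneg _),
    ← Real.sqrt_mul hc0]
  exact Real.abs_le_sqrt ((hc p hp).trans (by gcongr; exact hX.energy_le_control p))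

/-- A continuous path whose increments are `h · dX` up to terms that are negligible against the
root of the control belongs to `QV`, with quadratic variation the limit of the sums of
`(h · dX)²`. -/
theorem InQVd.inQV_of_inc_sub_incDot (hX : InQVd P X) {h : ℝ≥0 → Fin d → ℝ} (hh : Continuous h)
    {Y : ℝ≥0 → ℝ} (hY : Continuous Y)
    (hr : ∀ t, (fun p => inc P Y p - incDot P h X p) =o[stepFilter P t] rootControl P X) :
    InQV P Y ∧ ∀ t, Tendsto (fun n => stepSum P (fun p => incDot P h X p ^ 2) n t) atTop
      (𝓝 (quadVar P Y t)) := by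
  obtain ⟨B, hB, hBc, -⟩ := hX.exists_tendsto_incDot_sq hh
  have hlim : ∀ t, Tendsto (fun n => stepSum P (fun p => inc P Y p ^ 2) n t) atTop
      (𝓝 (B t)) := fun t => by
    -- Difference of squares: with b = h·dX, the product (dY − b)(dY − b + 2b) is o(root) · O(root),
    -- hence o(control).
    have h1 : (fun p => (inc P Y p - incDot P h X p) *
        (inc P Y p - incDot P h X p + 2 * incDot P h X p)) =o[stepFilter P t] control P X := by
      have := (hr t).mul_isBigO ((hr t).isBigO.add ((hX.incDot_isBigO hh t).const_mul_left 2))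
      simpa only [hX.rootControl_mul_self] using this
    have h2 := (hB t).add (hX.tendsto_stepSum_zero h1)
    rw [add_zero] at h2
    refine h2.congr fun n => ?_
    rw [← stepSum_add]
    congr 1
    funext p
    ring
  refine ⟨inQV_of_tendsto hY hBc hlim, fun t => ?_⟩
  rw [quadVar_eq_of_tendsto (hlim t)]
  exact hB t

end Brackets

/-! ### The log-partition functional on continuous functions. -/

theorem abs_integral_le_of_abs_le {K : Type*} [MeasurableSpace K] (μ : Measure K)
    [IsProbabilityMeasure μ] {g : K → ℝ} {c : ℝ} (h : ∀ x, |g x| ≤ c) : |∫ x, g x ∂μ| ≤ c := by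
  simpa using norm_integral_le_of_norm_le_const (μ := μ) (f := g) (Eventually.of_forall h)

/-- Evaluation at a point is a continuous algebra homomorphism. The Banach algebra exponential
therefore acts pointwise, and its analyticity gives smoothness of `logPartition`. -/
theorem exp_continuousMap_apply {K : Type*} [TopologicalSpace K] [CompactSpace K] (g : C(K, ℝ))
    (x : K) :
    NormedSpace.exp g x = Real.exp (g x) := by
  have h := NormedSpace.map_exp (ContinuousMap.evalAlgHom ℝ ℝ x)
    (continuous_eval_const x) g
  rw [Real.exp_eq_exp_ℝ]
  exact h

section LogPartition

variable {K : Type*} [TopologicalSpace K] [CompactSpace K] [MeasurableSpace K] [BorelSpace K]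
  (μ : Measure K) [IsProbabilityMeasure μ]

theorem integrable_continuousMap (g : C(K, ℝ)) : Integrable g μ := by
  refine Integrable.of_bound g.continuous.measurable.aestronglyMeasurable ‖g‖
    (Eventually.of_forall fun x => g.norm_coe_le_norm x)

theorem integrable_of_continuous {g : K → ℝ} (hg : Continuous g) :
    Integrable g μ :=
  integrable_continuousMap μ ⟨g, hg⟩

/-- Integration against a probability measure as a continuous linear functional. -/
def integralCLM : C(K, ℝ) →L[ℝ] ℝ :=
  LinearMap.mkContinuous
    { toFun := fun g => ∫ x, g x ∂μ
      map_add' := fun f g => integral_add (integrable_continuousMap μ f)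
        (integrable_continuousMap μ g)
      map_smul' := fun c g => integral_const_mul c _ } 1 fun g => by
    refine (norm_integral_le_of_norm_le_const
      (Eventually.of_forall fun x => g.norm_coe_le_norm x)).trans_eq ?_
    simp

/-- The functional `g ↦ log ∫ exp g dμ`. -/
def logPartition (g : C(K, ℝ)) : ℝ :=
  Real.log (∫ x, Real.exp (g x) ∂μ)

theorem integral_exp_eq (g : C(K, ℝ)) :
    ∫ x, Real.exp (g x) ∂μ = integralCLM μ (NormedSpace.exp g) :=
  integral_congr_ae (Eventually.of_forall fun x => (exp_continuousMap_apply g x).symm)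

theorem integrable_exp (g : C(K, ℝ)) : Integrable (fun x => Real.exp (g x)) μ :=
  integrable_of_continuous μ (by fun_prop)

theorem integral_exp_continuousMap_pos (g : C(K, ℝ)) : 0 < ∫ x, Real.exp (g x) ∂μ :=
  integral_exp_pos (integrable_exp μ g)

theorem exp_logPartition (g : C(K, ℝ)) :
    Real.exp (logPartition μ g) = ∫ x, Real.exp (g x) ∂μ :=
  Real.exp_log (integral_exp_continuousMap_pos μ g)

theorem contDiff_logPartition {n : WithTop ℕ∞} : ContDiff ℝ n (logPartition μ) := by
  have h : ContDiff ℝ n fun g : C(K, ℝ) => ∫ x, Real.exp (g x) ∂μ := by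
    simp only [integral_exp_eq]
    refine (integralCLM μ).contDiff.comp ?_
    exact AnalyticOnNhd.contDiff fun g _ => NormedSpace.exp_analytic g
  exact h.log fun g => (integral_exp_continuousMap_pos μ g).ne'

theorem fderiv_logPartition (g v : C(K, ℝ)) :
    fderiv ℝ (logPartition μ) g v = ∫ x, v x ∂(μ.tilted g) := by
  have h1 : HasFDerivAt (fun g : C(K, ℝ) => ∫ x, Real.exp (g x) ∂μ)
      ((integralCLM μ).comp (NormedSpace.exp g • (1 : C(K, ℝ) →L[ℝ] C(K, ℝ)))) g := by
    simp only [integral_exp_eq]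
    exact (integralCLM μ).hasFDerivAt.comp g hasFDerivAt_exp
  have h2 := (h1.log (integral_exp_continuousMap_pos μ g).ne').fderiv
  rw [show fderiv ℝ (logPartition μ) g = _ from h2, integral_tilted]
  simp only [smul_eq_mul, div_mul_eq_mul_div]
  rw [integral_div, div_eq_inv_mul, smul_apply, smul_eq_mul]
  congr 1
  refine integral_congr_ae (Eventually.of_forall fun x => ?_)
  simp [exp_continuousMap_apply]

/-- The tilted mean is a derivative of the smooth functional `logPartition`; this is the source of
continuity for the averaged weights. -/
theorem continuous_integral_tilted (v : C(K, ℝ)) :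
    Continuous fun g : C(K, ℝ) => ∫ x, v x ∂(μ.tilted g) := by
  simp only [← fderiv_logPartition]
  exact ((contDiff_logPartition μ (n := 1)).continuous_fderiv one_ne_zero).clm_apply
    continuous_const

theorem isProbabilityMeasure_tilted_continuousMap (g : C(K, ℝ)) :
    IsProbabilityMeasure (μ.tilted g) :=
  isProbabilityMeasure_tilted (integrable_exp μ g)

/-- Second order cumulant expansion of `log ∫ exp y` for small `y`. -/
theorem abs_logPartition_sub_le (y : C(K, ℝ)) {ρ : ℝ} (hρ : ρ ≤ 1 / 4) (hy : ∀ x, |y x| ≤ ρ) :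
    |logPartition μ y - ((∫ x, y x ∂μ) + 1 / 2 * (∫ x, y x ^ 2 ∂μ) -
      1 / 2 * (∫ x, y x ∂μ) ^ 2)| ≤ 20 * ρ ^ 3 := by
  have hρ0 : 0 ≤ ρ := (abs_nonneg _).trans
    (abs_integral_le_of_abs_le μ hy)
  set a := ∫ x, y x ∂μ with ha
  set b := ∫ x, y x ^ 2 ∂μ with hb
  set u := (∫ x, Real.exp (y x) ∂μ) - 1 with hu
  have ha' : |a| ≤ ρ := abs_integral_le_of_abs_le μ hy
  have hb' : |b| ≤ ρ ^ 2 := abs_integral_le_of_abs_le μ fun x => by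
    rw [abs_pow]; exact pow_le_pow_left₀ (abs_nonneg _) (hy x) 2
  have hexp : ∀ x, |Real.exp (y x) - 1 - y x - 1 / 2 * y x ^ 2| ≤ ρ ^ 3 := fun x => by
    have h := Real.exp_bound (x := y x) ((hy x).trans (by linarith)) (n := 3) (by norm_num)
    have h3 : |y x| ^ 3 ≤ ρ ^ 3 := pow_le_pow_left₀ (abs_nonneg _) (hy x) 3
    simp only [Finset.sum_range_succ, Finset.sum_range_zero, Nat.factorial] at h
    norm_num at h
    rw [show Real.exp (y x) - 1 - y x - 1 / 2 * y x ^ 2 =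
      Real.exp (y x) - (1 + y x + y x ^ 2 / 2) by ring]
    have : 0 ≤ |y x| ^ 3 := by positivity
    linarith
  have hub : |u - a - 1 / 2 * b| ≤ ρ ^ 3 := by
    have i1 := integrable_exp μ y
    have i2 := integrable_continuousMap μ y
    have i3 : Integrable (fun x => 1 / 2 * y x ^ 2) μ :=
      integrable_of_continuous μ (by fun_prop)
    have h := abs_integral_le_of_abs_le μ hexp
    have i4 : Integrable (fun x => Real.exp (y x) - 1) μ := i1.sub (integrable_const 1)
    have i5 : Integrable (fun x => Real.exp (y x) - 1 - y x) μ := i4.sub i2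
    rw [integral_sub i5 i3, integral_sub i4 i2, integral_sub i1 (integrable_const 1),
      integral_const_mul] at h
    simpa using h
  have h2 : ρ ^ 2 ≤ 1 / 4 * ρ := by nlinarith
  have h3 : ρ ^ 3 ≤ 1 / 4 * ρ ^ 2 := by nlinarith [sq_nonneg ρ]
  have hρ3 : 0 ≤ ρ ^ 3 := by positivity
  have hua : |u - a| ≤ ρ ^ 2 := by
    rw [abs_le] at *
    constructor <;> linarith [hub.1, hub.2, hb'.1, hb'.2]
  have hua' : |u + a| ≤ 3 * ρ := by
    rw [abs_le] at *
    constructor <;> linarith [hua.1, hua.2, ha'.1, ha'.2]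
  have hu2 : |u| ≤ 2 * ρ := by
    rw [abs_le] at *
    constructor <;> linarith [hua.1, hua.2, ha'.1, ha'.2]
  have hlog := Real.abs_log_sub_add_sum_range_le (x := -u)
    (by rw [abs_neg]; linarith) 2
  rw [abs_neg] at hlog
  -- Here |u|³ ≤ 8ρ³ and 1 − |u| ≥ 1/2. The total error is then 16ρ³ from the logarithm, ρ³ from
  -- `hub` and (3/2)ρ³ from `hsq`, which stays below 20ρ³.
  have hlog2 : |u| ^ 3 / (1 - |u|) ≤ 16 * ρ ^ 3 := by
    rw [div_le_iff₀ (by linarith)]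
    have : |u| ^ 3 ≤ (2 * ρ) ^ 3 := pow_le_pow_left₀ (abs_nonneg _) hu2 3
    nlinarith
  have hlog3 : |Real.log (1 + u) - u + u ^ 2 / 2| ≤ 16 * ρ ^ 3 := by
    refine le_trans (le_of_eq ?_) (hlog.trans hlog2)
    simp only [Finset.sum_range_succ, Finset.sum_range_zero]
    rw [sub_neg_eq_add]
    congr 1
    push_cast
    ring
  have hsq : |u ^ 2 - a ^ 2| ≤ 3 * ρ ^ 3 := by
    rw [show u ^ 2 - a ^ 2 = (u - a) * (u + a) by ring, abs_mul]
    calc |u - a| * |u + a| ≤ ρ ^ 2 * (3 * ρ) := by gcongr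
      _ = 3 * ρ ^ 3 := by ring
  have hl : logPartition μ y = Real.log (1 + u) := by
    rw [logPartition, hu]; congr 1; ring
  rw [hl]
  rw [abs_le] at *
  constructor <;> linarith [hub.1, hub.2, hlog3.1, hlog3.2, hsq.1, hsq.2]

/-- Dividing the two integrals produces the tilted density, so an expansion at 0 valid for all
probability measures gives one at every base point. -/
theorem logPartition_add_sub (g y : C(K, ℝ)) :
    logPartition μ (g + y) - logPartition μ g = logPartition (μ.tilted g) y := by
  rw [logPartition, logPartition, logPartition, integral_exp_tilted,
    ← Real.log_div (integral_exp_continuousMap_pos μ (g + y)).ne'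
      (integral_exp_continuousMap_pos μ g).ne']
  rfl

end LogPartition

/-! ### Joint smoothness implies the regularity required of integrands. -/

section Regularity

variable {d m : ℕ}

theorem isC21On_of_contDiff {f : (Fin d → ℝ) → (Fin m → ℝ) → ℝ}
    (hf : ContDiff ℝ 2 fun p : (Fin d → ℝ) × (Fin m → ℝ) => f p.1 p.2) :
    IsC21On f Set.univ Set.univ := by
  refine ⟨(hf.of_le one_le_two).contDiffOn, fun a _ => ?_, ?_⟩
  · exact (hf.comp (contDiff_id.prodMk contDiff_const)).contDiffOn
  · let ι : (Fin d → ℝ) →L[ℝ] (Fin d → ℝ) × (Fin m → ℝ) := ContinuousLinearMap.inl ℝ _ _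
    let F : (Fin d → ℝ) × (Fin m → ℝ) → ℝ := fun p => f p.1 p.2
    -- The partial second derivative is the full one restricted along the inclusion of the first
    -- factor.
    have h : ∀ p : (Fin d → ℝ) × (Fin m → ℝ), iteratedFDeriv ℝ 2 (fun x => f x p.2) p.1 =
        (iteratedFDeriv ℝ 2 F p).compContinuousLinearMap fun _ => ι := fun p => by
      have e : (fun x => f x p.2) = (fun z => F (z + (0, p.2))) ∘ ι := by
        funext x; simp [F, ι]
      have hF : ContDiff ℝ 2 fun z => F (z + (0, p.2)) := hf.comp (contDiff_id.add contDiff_const)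
      rw [e, ι.iteratedFDeriv_comp_right hF _ le_rfl, iteratedFDeriv_comp_add_right]
      simp [ι]
    simp only [h]
    exact ((ContinuousMultilinearMap.compContinuousLinearMapL (𝕜 := ℝ) (F := ℝ)
      (fun _ : Fin 2 => ι)).continuous.comp (hf.continuous_iteratedFDeriv le_rfl)).continuousOn

end Regularity

/-! ### The exponent as a function of position and bracket matrix. -/

section Exponent

variable {d : ℕ}

/-- The coordinate functions on the simplex. -/
def coord (i : Fin d) : C(stdSimplex ℝ (Fin d), ℝ) :=
  ⟨fun π => (π : Fin d → ℝ) i, (continuous_apply i).comp continuous_subtype_val⟩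

/-- The function `π ↦ π · x - (1/2) ∑ a_{ij} π_i π_j`, for a matrix `a` listed as a vector. -/
def exponent (x : Fin d → ℝ) (a : Fin (d * d) → ℝ) : C(stdSimplex ℝ (Fin d), ℝ) :=
  (∑ i, x i • coord i) -
    (1 / 2 : ℝ) • ∑ i, ∑ j, a (finProdFinEquiv (i, j)) • (coord i * coord j)

theorem exponent_apply (x : Fin d → ℝ) (a : Fin (d * d) → ℝ) (π : stdSimplex ℝ (Fin d)) :
    exponent x a π = (∑ i, (π : Fin d → ℝ) i * x i) - 1 / 2 * ∑ i, ∑ j,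
      (π : Fin d → ℝ) i * (π : Fin d → ℝ) j * a (finProdFinEquiv (i, j)) := by
  simp [exponent, coord, mul_comm]

theorem exponent_add (x y : Fin d → ℝ) (a b : Fin (d * d) → ℝ) :
    exponent (x + y) (a + b) = exponent x a + exponent y b := by
  simp only [exponent, Pi.add_apply, add_smul, Finset.sum_add_distrib, smul_add]
  abel

theorem contDiff_exponent {n : WithTop ℕ∞} (x₀ : Fin d → ℝ) :
    ContDiff ℝ n fun p : (Fin d → ℝ) × (Fin (d * d) → ℝ) => exponent (p.1 - x₀) p.2 := by
  unfold exponent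
  simp only [Pi.sub_apply]
  fun_prop

variable (μ : Measure (stdSimplex ℝ (Fin d))) [IsProbabilityMeasure μ]

/-- The exponent is affine in `x`, with coordinate functions as partial derivatives, so the chain
rule gives tilted means. -/
theorem gradX_logPartition_exponent (x₀ x : Fin d → ℝ) (a : Fin (d * d) → ℝ) (i : Fin d) :
    gradX (fun x a => logPartition μ (exponent (x - x₀) a)) x a i =
      ∫ π, (π : Fin d → ℝ) i ∂(μ.tilted (exponent (x - x₀) a)) := by
  let ℓ : (Fin d → ℝ) →L[ℝ] C(stdSimplex ℝ (Fin d), ℝ) :=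
    ∑ j, (ContinuousLinearMap.proj (R := ℝ) (φ := fun _ : Fin d => ℝ) j).smulRight (coord j)
  have hℓ : HasFDerivAt (fun y => exponent (y - x₀) a) ℓ x := by
    have e : (fun y => exponent (y - x₀) a) = fun y => ℓ y + exponent (-x₀) a := by
      funext y
      have := exponent_add y (-x₀) 0 a
      rw [zero_add, ← sub_eq_add_neg] at this
      rw [this]
      congr 1
      simp [exponent, ℓ]
    rw [e]
    exact ℓ.hasFDerivAt.add_const _
  have hL : DifferentiableAt ℝ (logPartition μ) (exponent (x - x₀) a) :=
    (contDiff_logPartition μ (n := 1)).differentiable one_ne_zero _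
  have h := HasFDerivAt.comp (g := logPartition μ) x hL.hasFDerivAt hℓ
  change HasFDerivAt (fun y => logPartition μ (exponent (y - x₀) a)) _ x at h
  rw [gradX, h.fderiv, ContinuousLinearMap.comp_apply, fderiv_logPartition]
  congr 1
  funext π
  have : ℓ (Pi.single i 1) = coord i := by
    simp [ℓ, Pi.single_apply]
  rw [this]
  rfl

theorem isC21On_logPartition_exponent (x₀ : Fin d → ℝ) :
    IsC21On (fun x (a : Fin (d * d) → ℝ) => logPartition μ (exponent (x - x₀) a))
      Set.univ Set.univ :=
  isC21On_of_contDiff ((contDiff_logPartition μ).comp (contDiff_exponent x₀))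

end Exponent

/-! ### Moments on the simplex and the expansion of the log-partition. -/

section Simplex

variable {d : ℕ}

theorem coord_nonneg (π : stdSimplex ℝ (Fin d)) (i : Fin d) : 0 ≤ (π : Fin d → ℝ) i :=
  π.2.1 i

theorem coord_le_one (π : stdSimplex ℝ (Fin d)) (i : Fin d) : (π : Fin d → ℝ) i ≤ 1 :=
  (Finset.single_le_sum (f := fun i => (π : Fin d → ℝ) i) (fun j _ => π.2.1 j)
    (Finset.mem_univ i)).trans_eq π.2.2

theorem continuous_coord (i : Fin d) :
    Continuous fun π : stdSimplex ℝ (Fin d) => (π : Fin d → ℝ) i :=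
  (coord i).continuous

variable (ν : Measure (stdSimplex ℝ (Fin d))) [IsProbabilityMeasure ν]

theorem integral_coord_mem_stdSimplex :
    (fun i => ∫ π : stdSimplex ℝ (Fin d), (π : Fin d → ℝ) i ∂ν) ∈ stdSimplex ℝ (Fin d) := by
  refine ⟨fun i => integral_nonneg fun π => coord_nonneg π i, ?_⟩
  rw [← integral_finsetSum _ fun i _ => integrable_of_continuous ν (continuous_coord i)]
  have : ∀ π : stdSimplex ℝ (Fin d), ∑ i, (π : Fin d → ℝ) i = 1 := fun π => π.2.2
  simp [this]

/-- Expansion of `log ∫ exp (π · x - (1/2) ∑ a_{ij} π_i π_j) ν(dπ)` to second order in `x` and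
first order in `a`. -/
theorem abs_logPartition_exponent_sub_le (x : Fin d → ℝ) (a : Fin (d * d) → ℝ) {c ρ : ℝ}
    (hc : c = ∑ i, ∑ j, |a (finProdFinEquiv (i, j))|) (hρ : ρ = (∑ i, |x i|) + c)
    (hρ4 : ρ ≤ 1 / 4) :
    |logPartition ν (exponent x a) -
      ((∑ i, (∫ π : stdSimplex ℝ (Fin d), (π : Fin d → ℝ) i ∂ν) * x i) +
        1 / 2 * (∑ i, ∑ j, (∫ π : stdSimplex ℝ (Fin d), (π : Fin d → ℝ) i *
          (π : Fin d → ℝ) j ∂ν) * (x i * x j - a (finProdFinEquiv (i, j)))) -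
        1 / 2 * (∑ i, (∫ π : stdSimplex ℝ (Fin d), (π : Fin d → ℝ) i ∂ν) * x i) ^ 2)| ≤
      20 * ρ ^ 3 + 2 * ρ * c := by
  have hc0 : 0 ≤ c := hc ▸ Finset.sum_nonneg fun _ _ => Finset.sum_nonneg fun _ _ => abs_nonneg _
  let l : stdSimplex ℝ (Fin d) → ℝ := fun π => ∑ i, (π : Fin d → ℝ) i * x i
  let q : stdSimplex ℝ (Fin d) → ℝ := fun π => ∑ i, ∑ j,
    (π : Fin d → ℝ) i * (π : Fin d → ℝ) j * a (finProdFinEquiv (i, j))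
  set y := exponent x a with hy
  have hyq : ∀ π, y π = l π - 1 / 2 * q π := exponent_apply x a
  have hl : ∀ π, |l π| ≤ ∑ i, |x i| := fun π => by
    refine (Finset.abs_sum_le_sum_abs _ _).trans (Finset.sum_le_sum fun i _ => ?_)
    rw [abs_mul, abs_of_nonneg (coord_nonneg π i)]
    exact mul_le_of_le_one_left (abs_nonneg _) (coord_le_one π i)
  have hq : ∀ π, |q π| ≤ c := fun π => by
    rw [hc]
    refine (Finset.abs_sum_le_sum_abs _ _).trans (Finset.sum_le_sum fun i _ =>
      (Finset.abs_sum_le_sum_abs _ _).trans (Finset.sum_le_sum fun j _ => ?_))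
    rw [abs_mul, abs_of_nonneg (mul_nonneg (coord_nonneg π i) (coord_nonneg π j))]
    exact mul_le_of_le_one_left (abs_nonneg _)
      (mul_le_one₀ (coord_le_one π i) (coord_nonneg π j) (coord_le_one π j))
  have hl' : ∀ π, |l π| ≤ ρ := fun π => (hl π).trans (by linarith)
  have hyl : ∀ π, |y π - l π| ≤ c := fun π => by
    have h := hq π
    rw [hyq]
    rw [abs_le] at h ⊢
    constructor <;> linarith [h.1, h.2]
  have hy' : ∀ π, |y π| ≤ ρ := fun π => by
    have h1 := hl π
    have h2 := hyl π
    rw [abs_le] at h1 h2 ⊢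
    constructor <;> linarith [h1.1, h1.2, h2.1, h2.2]
  -- Dropping the quadratic part from `y` changes squares by at most `2 * ρ * c`. It is used for the
  -- mean square and for the squared mean, each with weight 1/2, giving the term `2 * ρ * c` in the
  -- bound.
  have hsq : ∀ u v : ℝ, |u| ≤ ρ → |v| ≤ ρ → |u - v| ≤ c → |u ^ 2 - v ^ 2| ≤ 2 * ρ * c := by
    intro u v hu hv huv
    rw [show u ^ 2 - v ^ 2 = (u + v) * (u - v) by ring, abs_mul]
    have : |u + v| ≤ 2 * ρ := (abs_add_le u v).trans (by linarith)
    exact mul_le_mul this huv (abs_nonneg _) ((abs_nonneg _).trans this)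
  have hlc : Continuous l := continuous_finsetSum _ fun i _ => (continuous_coord i).mul_const _
  have hqc : Continuous q := continuous_finsetSum _ fun i _ => continuous_finsetSum _ fun j _ =>
    ((continuous_coord i).mul (continuous_coord j)).mul_const _
  have il := integrable_of_continuous ν hlc
  have iy := integrable_continuousMap ν y
  have iy2 : Integrable (fun π => y π ^ 2) ν := integrable_of_continuous ν (by fun_prop)
  have il2 : Integrable (fun π => l π ^ 2) ν := integrable_of_continuous ν (by fun_prop)
  have iq := integrable_of_continuous ν hqc
  have el : ∫ π, l π ∂ν = ∑ i, (∫ π : stdSimplex ℝ (Fin d), (π : Fin d → ℝ) i ∂ν) * x i := by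
    rw [integral_finsetSum _ fun i _ =>
      integrable_of_continuous ν ((continuous_coord i).mul_const _)]
    exact Finset.sum_congr rfl fun i _ => integral_mul_const _ _
  have e2 : ∀ b : Fin d → Fin d → ℝ, ∫ π : stdSimplex ℝ (Fin d), ∑ i, ∑ j, (π : Fin d → ℝ) i *
      (π : Fin d → ℝ) j * b i j ∂ν = ∑ i, ∑ j, (∫ π : stdSimplex ℝ (Fin d), (π : Fin d → ℝ) i *
        (π : Fin d → ℝ) j ∂ν) * b i j := fun b => by
    have hc : ∀ i j, Continuous fun π : stdSimplex ℝ (Fin d) => (π : Fin d → ℝ) i *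
        (π : Fin d → ℝ) j * b i j := fun i j =>
      ((continuous_coord i).mul (continuous_coord j)).mul_const _
    rw [integral_finsetSum _ fun i _ => integrable_of_continuous ν
      (continuous_finsetSum _ fun j _ => hc i j)]
    refine Finset.sum_congr rfl fun i _ => ?_
    rw [integral_finsetSum _ fun j _ => integrable_of_continuous ν (hc i j)]
    exact Finset.sum_congr rfl fun j _ => integral_mul_const _ _
  have el2 : ∫ π, l π ^ 2 ∂ν = ∑ i, ∑ j, (∫ π : stdSimplex ℝ (Fin d), (π : Fin d → ℝ) i *
      (π : Fin d → ℝ) j ∂ν) * (x i * x j) := by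
    rw [← e2]
    refine integral_congr_ae (Eventually.of_forall fun π => ?_)
    simp only [l]
    rw [sq, Finset.sum_mul_sum]
    refine Finset.sum_congr rfl fun i _ => Finset.sum_congr rfl fun j _ => ?_
    ring
  have eq' : ∫ π, q π ∂ν = ∑ i, ∑ j, (∫ π : stdSimplex ℝ (Fin d), (π : Fin d → ℝ) i *
      (π : Fin d → ℝ) j ∂ν) * a (finProdFinEquiv (i, j)) :=
    e2 fun i j => a (finProdFinEquiv (i, j))
  have ey : ∫ π, y π ∂ν = (∫ π, l π ∂ν) - 1 / 2 * ∫ π, q π ∂ν := by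
    rw [← integral_const_mul, ← integral_sub il (iq.const_mul _)]
    exact integral_congr_ae (Eventually.of_forall hyq)
  have h1 := abs_logPartition_sub_le ν y hρ4 hy'
  have h2 : |(∫ π, y π ^ 2 ∂ν) - ∫ π, l π ^ 2 ∂ν| ≤ 2 * ρ * c := by
    rw [← integral_sub iy2 il2]
    exact abs_integral_le_of_abs_le ν fun π => hsq _ _ (hy' π) (hl' π) (hyl π)
  have h3 : |(∫ π, y π ∂ν) ^ 2 - (∫ π, l π ∂ν) ^ 2| ≤ 2 * ρ * c :=
    hsq _ _ (abs_integral_le_of_abs_le ν hy') (abs_integral_le_of_abs_le ν hl')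
      (by rw [← integral_sub iy il]; exact abs_integral_le_of_abs_le ν hyl)
  simp only [mul_sub (∫ π : stdSimplex ℝ (Fin d), _ ∂ν), Finset.sum_sub_distrib]
  rw [← el, ← el2, ← eq']
  rw [abs_le] at h1 h2 h3 ⊢
  constructor <;> linarith [h1.1, h1.2, h2.1, h2.2, h3.1, h3.2]

end Simplex

/-! ### Constant weights: explicit values. -/

section ConstantWeights

variable {P : RefiningPartitions} {d : ℕ} {X : ℝ≥0 → Fin d → ℝ}

variable (P X) in
/-- The brackets `⟨X^i, X^j⟩`, listed as a vector. -/
def bracketVec (t : ℝ≥0) : Fin (d * d) → ℝ := fun k =>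
  bracket P X (finProdFinEquiv.symm k).1 (finProdFinEquiv.symm k).2 t

variable (P X) in
/-- The function `π ↦ π · (X_t - X_0) - (1/2) ∑ π_i π_j ⟨X^i, X^j⟩_t`. -/
def logValue (t : ℝ≥0) : C(stdSimplex ℝ (Fin d), ℝ) :=
  exponent (X t - X 0) (bracketVec P X t)

theorem InQVd.continuous_bracketVec (hX : InQVd P X) : Continuous (bracketVec P X) :=
  continuous_pi fun _ => hX.continuous_bracket _ _

theorem InQVd.continuous_logValue (hX : InQVd P X) : Continuous (logValue P X) :=
  (contDiff_exponent (n := 0) (X 0)).continuous.comp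
    (hX.continuous.prodMk hX.continuous_bracketVec)

theorem logValue_apply (t : ℝ≥0) (π : stdSimplex ℝ (Fin d)) :
    logValue P X t π = (∑ i, (π : Fin d → ℝ) i * (X t i - X 0 i)) - 1 / 2 * ∑ i, ∑ j,
      (π : Fin d → ℝ) i * (π : Fin d → ℝ) j * bracket P X i j t := by
  simp [logValue, exponent_apply, bracketVec]

theorem logValue_zero : logValue P X 0 = 0 := by
  ext π
  simp [logValue_apply, bracket_zero]

theorem follmerSum_eq (ξ : ℝ≥0 → Fin d → ℝ) (n : ℕ) (t : ℝ≥0) :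
    follmerSum P ξ X n t = stepSum P (incDot P ξ X) n t :=
  rfl

theorem InQVd.tendsto_follmerSum_const (hX : InQVd P X) (w : Fin d → ℝ) (t : ℝ≥0) :
    Tendsto (fun n => follmerSum P (fun _ => w) X n t) atTop
      (𝓝 (∑ i, w i * (X t i - X 0 i))) := by
  have h := tendsto_finsetSum Finset.univ fun i _ =>
    (tendsto_stepSum_inc (P := P) (hX.inQV i).continuous t).const_mul (w i)
  refine h.congr fun n => ?_
  simp only [← stepSum_const_mul]
  rw [← stepSum_sum]
  rfl

theorem InQVd.follmerIntegral_const (hX : InQVd P X) (w : Fin d → ℝ) (t : ℝ≥0) :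
    follmerIntegral P (fun _ => w) X t = ∑ i, w i * (X t i - X 0 i) :=
  (hX.tendsto_follmerSum_const w t).limUnder_eq

theorem InQVd.follmerIntegral_const_inQV (hX : InQVd P X) (w : Fin d → ℝ) :
    InQV P (follmerIntegral P (fun _ => w) X) ∧ ∀ t,
      quadVar P (follmerIntegral P (fun _ => w) X) t =
        ∑ i, ∑ j, w i * w j * bracket P X i j t := by
  have e : follmerIntegral P (fun _ => w) X = fun t => ∑ i, w i * (X t i - X 0 i) :=
    funext (hX.follmerIntegral_const w)
  have hXi := fun i => (hX.inQV i).continuous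
  obtain ⟨h1, h2⟩ := hX.inQV_of_inc_sub_incDot (h := fun _ => w) continuous_const
    (Y := fun t => ∑ i, w i * (X t i - X 0 i)) (by fun_prop) fun t => by
      refine (isLittleO_zero _ _).congr_left fun p => ?_
      simp only [inc, incDot]
      rw [← Finset.sum_sub_distrib, ← Finset.sum_sub_distrib]
      refine (Finset.sum_eq_zero fun i _ => ?_).symm
      ring
  rw [e]
  refine ⟨h1, fun t => tendsto_nhds_unique (h2 t) ?_⟩
  simp only [incDot_sq_eq, stepSum_sum, stepSum_const_mul]
  exact tendsto_finsetSum _ fun i _ => tendsto_finsetSum _ fun j _ =>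
    (hX.tendsto_bracket i j t).const_mul _

theorem InQVd.ddExp_follmerIntegral_const (hX : InQVd P X) (π : stdSimplex ℝ (Fin d))
    (t : ℝ≥0) :
    ddExp P (follmerIntegral P (fun _ => (π : Fin d → ℝ)) X) t =
      Real.exp (logValue P X t π) := by
  rw [ddExp, (hX.follmerIntegral_const_inQV _).2, hX.follmerIntegral_const, logValue_apply]

end ConstantWeights

/-! ### Averaged weights and the value identity. -/

section AveragedWeights

variable {P : RefiningPartitions} {d : ℕ} {X : ℝ≥0 → Fin d → ℝ}
  (μ : Measure (stdSimplex ℝ (Fin d)))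

variable (P X) in
/-- The mean of `π_i` under the probability measure with density proportional to
`exp (logValue P X t)`. -/
def tiltedMean (t : ℝ≥0) (i : Fin d) : ℝ :=
  ∫ π : stdSimplex ℝ (Fin d), (π : Fin d → ℝ) i ∂(μ.tilted (logValue P X t))

variable (P X) in
/-- The mean of `π_i π_j` under the probability measure with density proportional to
`exp (logValue P X t)`. -/
def tiltedSecondMoment (i j : Fin d) (t : ℝ≥0) : ℝ :=
  ∫ π : stdSimplex ℝ (Fin d), (π : Fin d → ℝ) i * (π : Fin d → ℝ) j
    ∂(μ.tilted (logValue P X t))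

variable [IsProbabilityMeasure μ]

theorem InQVd.continuous_tiltedMean (hX : InQVd P X) : Continuous (tiltedMean P X μ) :=
  continuous_pi fun i => (continuous_integral_tilted μ (coord i)).comp hX.continuous_logValue

theorem InQVd.continuous_tiltedSecondMoment (hX : InQVd P X) (i j : Fin d) :
    Continuous (tiltedSecondMoment P X μ i j) :=
  (continuous_integral_tilted μ (coord i * coord j)).comp hX.continuous_logValue

theorem InQVd.continuous_logPartition (hX : InQVd P X) :
    Continuous fun t => logPartition μ (logValue P X t) :=
  (contDiff_logPartition μ (n := 0)).continuous.comp hX.continuous_logValue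

/-- Linearity of `exponent` makes the increment of `logValue` a function of the increments of path
and brackets; the tilt sits at the left end point, as a nonanticipative sum needs. -/
theorem inc_logPartition (p : ℕ × ℕ) :
    inc P (fun t => logPartition μ (logValue P X t)) p =
      logPartition (μ.tilted (logValue P X (P.pt p.1 p.2)))
        (exponent (fun i => inc P (fun t => X t i) p)
          (fun k => inc P (fun t => bracketVec P X t k) p)) := by
  rw [← logPartition_add_sub, logValue, ← exponent_add]
  simp only [inc]
  congr 2
  rw [logValue]
  congr 1
  · funext i; simp
  · funext k; simp

/-- The second order expansion of the increments of `log ∫ exp (logValue) dμ`. -/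
theorem InQVd.inc_logPartition_sub_isLittleO (hX : InQVd P X) (t : ℝ≥0) :
    (fun p => inc P (fun t => logPartition μ (logValue P X t)) p -
      (incDot P (tiltedMean P X μ) X p +
        1 / 2 * (∑ i, ∑ j, tiltedSecondMoment P X μ i j (P.pt p.1 p.2) *
          (inc P (fun t => X t i) p * inc P (fun t => X t j) p - inc P (bracket P X i j) p)) -
        1 / 2 * incDot P (tiltedMean P X μ) X p ^ 2)) =o[stepFilter P t] control P X := by
  let c : ℕ × ℕ → ℝ := fun p => ∑ i, ∑ j, |inc P (bracket P X i j) p|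
  let ρ : ℕ × ℕ → ℝ := fun p => (∑ i, |inc P (fun t => X t i) p|) + c p
  -- Bracket increments are O(control) and path increments O(root), so both ρ³ and ρc are
  -- o(control).
  have hc : c =O[stepFilter P t] control P X := by
    refine IsBigO.fun_sum fun i _ => IsBigO.fun_sum fun j _ => IsBigO.of_bound 1
      (Eventually.of_forall fun p => ?_)
    rw [one_mul, Real.norm_eq_abs, Real.norm_eq_abs, abs_abs,
      abs_of_nonneg (hX.control_nonneg p)]
    exact (hX.abs_bracket_sub_le i j (pt_le_succ _ _)).trans (inc_totalVar_le_control p)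
  have hρ : ρ =O[stepFilter P t] rootControl P X :=
    (IsBigO.fun_sum fun i _ => (hX.inc_isBigO i t).abs_left).add
      (hc.trans (hX.control_isLittleO t).isBigO)
  have hρ0 : Tendsto ρ (stepFilter P t) (𝓝 0) := hρ.trans_tendsto (hX.tendsto_rootControl t)
  have hρ1 := (isLittleO_one_iff ℝ).2 hρ0
  have h1 : (fun p => 20 * ρ p ^ 3 + 2 * ρ p * c p) =o[stepFilter P t] control P X := by
    have hcube : (fun p => ρ p * (ρ p * ρ p)) =o[stepFilter P t] control P X := by
      have := hρ1.mul_isBigO (hρ.mul hρ)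
      simpa only [one_mul, hX.rootControl_mul_self] using this
    have hmul : (fun p => ρ p * c p) =o[stepFilter P t] control P X := by
      simpa only [one_mul] using hρ1.mul_isBigO hc
    refine ((hcube.const_mul_left 20).add (hmul.const_mul_left 2)).congr_left fun p => ?_
    ring
  refine IsBigO.trans_isLittleO (IsBigO.of_bound 1 ?_) h1
  filter_upwards [hρ0.eventually_le_const (show (0 : ℝ) < 1 / 4 by norm_num)] with p hp
  have := isProbabilityMeasure_tilted_continuousMap μ (logValue P X (P.pt p.1 p.2))
  rw [one_mul, Real.norm_eq_abs, inc_logPartition]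
  refine le_trans (le_of_eq ?_) ((abs_logPartition_exponent_sub_le
    (μ.tilted (logValue P X (P.pt p.1 p.2))) (fun i => inc P (fun t => X t i) p)
    (fun k => inc P (fun t => bracketVec P X t k) p) (c := c p) (ρ := ρ p)
    (by simp [c, bracketVec]) rfl hp).trans (le_abs_self _))
  simp [bracketVec, incDot, tiltedMean, tiltedSecondMoment]

/-- The Föllmer integral of the averaged weights exists, and its Doléans–Dade exponential is the
average of the values of the constant weights. -/
theorem InQVd.follmerIntegral_tiltedMean (hX : InQVd P X) :
    (∀ t, ∃ I, Tendsto (fun n => follmerSum P (tiltedMean P X μ) X n t) atTop (𝓝 I)) ∧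
    InQV P (follmerIntegral P (tiltedMean P X μ) X) ∧
    ∀ t, ddExp P (follmerIntegral P (tiltedMean P X μ) X) t =
      ∫ π, Real.exp (logValue P X t π) ∂μ := by
  have hw := hX.continuous_tiltedMean μ
  have hZ := hX.continuous_logPartition μ
  obtain ⟨B, hB, hBc, hBK⟩ := hX.exists_tendsto_incDot_sq hw
  let Z : ℝ≥0 → ℝ := fun t => logPartition μ (logValue P X t)
  let D : ℕ × ℕ → ℝ := fun p => ∑ i, ∑ j, tiltedSecondMoment P X μ i j (P.pt p.1 p.2) *
    (inc P (fun t => X t i) p * inc P (fun t => X t j) p - inc P (bracket P X i j) p)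
  have hZ0 : Z 0 = 0 := by simp [Z, logValue_zero, logPartition]
  have hD : ∀ t, Tendsto (fun n => stepSum P D n t) atTop (𝓝 0) := fun t => by
    have := tendsto_finsetSum Finset.univ fun i _ => tendsto_finsetSum Finset.univ fun j _ =>
      hX.stepSum_weighted_compensated (hX.continuous_tiltedSecondMoment μ i j) i j t
    simpa only [D, stepSum_sum, Finset.sum_const_zero] using this
  have hR := hX.inc_logPartition_sub_isLittleO μ
  -- The expansion is solved for the Riemann increment and summed.
  have hI : ∀ t, Tendsto (fun n => follmerSum P (tiltedMean P X μ) X n t) atTop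
      (𝓝 (Z t + 1 / 2 * B t)) := fun t => by
    have h := (((tendsto_stepSum_inc (P := P) hZ t).sub (hX.tendsto_stepSum_zero (hR t))).sub
      ((hD t).const_mul (1 / 2))).add ((hB t).const_mul (1 / 2))
    rw [show Z t + 1 / 2 * B t = Z t - Z 0 - 0 - 1 / 2 * 0 + 1 / 2 * B t by rw [hZ0]; ring]
    refine h.congr fun n => ?_
    rw [← stepSum_const_mul, ← stepSum_const_mul, ← stepSum_sub, ← stepSum_sub, ← stepSum_add,
      follmerSum_eq]
    congr 1
    funext p
    simp only [D]
    ring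
  have hIe : follmerIntegral P (tiltedMean P X μ) X = fun t => Z t + 1 / 2 * B t :=
    funext fun t => (hI t).limUnder_eq
  -- For the quadratic variation a cruder estimate suffices: all second order terms are O(control),
  -- hence o(root).
  have hrem : ∀ t, (fun p => inc P (fun t => Z t + 1 / 2 * B t) p -
      incDot P (tiltedMean P X μ) X p) =o[stepFilter P t] rootControl P X := fun t => by
    have hsec : D =O[stepFilter P t] control P X := by
      refine IsBigO.fun_sum fun i _ => IsBigO.fun_sum fun j _ => ?_
      obtain ⟨c, hc0, hc⟩ := exists_bound_on_Icc (hX.continuous_tiltedSecondMoment μ i j) t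
      refine IsBigO.of_bound c (eventually_stepFilter_of_forall fun p hp => ?_)
      rw [Real.norm_eq_abs, Real.norm_eq_abs, abs_of_nonneg (hX.control_nonneg p), abs_mul]
      refine mul_le_mul (hc _ ((pt_le_succ _ _).trans hp)) ?_ (abs_nonneg _) hc0
      exact (abs_sub _ _).trans (add_le_add (abs_inc_mul_inc_le i j p)
        (hX.abs_bracket_sub_le i j (pt_le_succ _ _)))
    have hsq : (fun p => incDot P (tiltedMean P X μ) X p ^ 2) =O[stepFilter P t]
        control P X := by
      have := (hX.incDot_isBigO hw t).mul (hX.incDot_isBigO hw t)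
      simpa only [hX.rootControl_mul_self, ← sq] using this
    have hincB : inc P B =O[stepFilter P t] control P X := by
      obtain ⟨c, hc0, hc⟩ := hBK t
      refine IsBigO.of_bound c (eventually_stepFilter_of_forall fun p hp => ?_)
      rw [Real.norm_eq_abs, Real.norm_eq_abs, abs_of_nonneg (hX.control_nonneg p)]
      exact (hc _ _ (pt_le_succ _ _) hp).trans
        (mul_le_mul_of_nonneg_left (inc_totalVar_le_control p) hc0)
    have hall := ((((hR t).isBigO.add (hsec.const_mul_left (1 / 2))).sub
      (hsq.const_mul_left (1 / 2))).add (hincB.const_mul_left (1 / 2)))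
    refine (hall.trans_isLittleO (hX.control_isLittleO t)).congr_left fun p => ?_
    rw [inc_add]
    simp only [inc, D, Z]
    ring
  obtain ⟨hqv, hqvlim⟩ := hX.inQV_of_inc_sub_incDot (Y := fun t => Z t + 1 / 2 * B t) hw
    (hZ.add (hBc.const_mul (1 / 2))) hrem
  refine ⟨fun t => ⟨_, hI t⟩, hIe ▸ hqv, fun t => ?_⟩
  -- The quadratic variation of the integral is `B`, which cancels the correction `1 / 2 * B t`.
  rw [ddExp, hIe, ← tendsto_nhds_unique (hB t) (hqvlim t), ← exp_logPartition]
  simp only [Z]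
  congr 1
  ring

end AveragedWeights

/-! ### Stability of the path class under logarithms. -/

section Logarithms

variable {P : RefiningPartitions} {d : ℕ} {S : ℝ≥0 → Fin d → ℝ}

theorem InQVd.quadVar_inc_isBigO {X : ℝ≥0 → Fin d → ℝ} (hX : InQVd P X) (i : Fin d) (t : ℝ≥0) :
    inc P (quadVar P fun t => X t i) =O[stepFilter P t] control P X := by
  refine IsBigO.of_bound 1 (Eventually.of_forall fun p => ?_)
  rw [one_mul, Real.norm_eq_abs, Real.norm_eq_abs, abs_of_nonneg (hX.control_nonneg p)]
  have := hX.abs_sub_le_totalVar (pt_le_succ (P := P) p.1 p.2) (tendsto_quadVar (hX.inQV i) _)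
    (tendsto_quadVar (hX.inQV i) _) (c := 1) (fun q _ => by
      rw [one_mul, abs_of_nonneg (sq_nonneg _)]; exact sq_inc_le_energy i q)
  rw [one_mul] at this
  exact this.trans (inc_totalVar_le_control p)

/-- If the increments of each `Y^i` are `h^i dX^i` up to negligible terms, then `Y ∈ QV^d`. -/
theorem InQVd.of_inc_sub_mul {X Y h : ℝ≥0 → Fin d → ℝ} (hX : InQVd P X) (hh : Continuous h)
    (hY : Continuous Y)
    (hr : ∀ i t, (fun p => inc P (fun t => Y t i) p -
      h (P.pt p.1 p.2) i * inc P (fun t => X t i) p) =o[stepFilter P t] rootControl P X) :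
    InQVd P Y := by
  refine ⟨hY, fun i j => ?_⟩
  have hsingle : ∀ (i : Fin d) (p : ℕ × ℕ), ∑ k, (Pi.single i (1 : ℝ) : Fin d → ℝ) k *
      h (P.pt p.1 p.2) k * inc P (fun t => X t k) p =
        h (P.pt p.1 p.2) i * inc P (fun t => X t i) p := fun i p => by
    simp [Pi.single_apply]
  refine (hX.inQV_of_inc_sub_incDot (h := fun t k => ((Pi.single i (1 : ℝ) : Fin d → ℝ) k +
    (Pi.single j (1 : ℝ) : Fin d → ℝ) k) * h t k) (by fun_prop) (by fun_prop) fun t => ?_).1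
  refine ((hr i t).add (hr j t)).congr_left fun p => ?_
  rw [inc_add, incDot]
  simp only [add_mul, Finset.sum_add_distrib, hsingle]
  ring

/-- With u = dS/S the increment of the logarithm is log(1 + u) = u + o(u). First order accuracy is
enough, because errors need only be small against the root of the control. -/
theorem InQVd.log (hS : InQVd P S) (hpos : ∀ t i, 0 < S t i) :
    InQVd P fun t i => Real.log (S t i) := by
  have hSi := fun i => (hS.inQV i).continuous
  have hinv : ∀ i, Continuous fun t => (S t i)⁻¹ := fun i =>
    (hSi i).inv₀ fun t => (hpos t i).ne'
  refine hS.of_inc_sub_mul (h := fun t i => (S t i)⁻¹) (continuous_pi hinv)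
    (continuous_pi fun i => (hSi i).log fun t => (hpos t i).ne') fun i t => ?_
  have hu : (fun p => (S (P.pt p.1 p.2) i)⁻¹ * inc P (fun t => S t i) p)
      =O[stepFilter P t] rootControl P S := by
    obtain ⟨c, hc0, hc⟩ := exists_bound_on_Icc (hinv i) t
    have h1 : (fun p : ℕ × ℕ => (S (P.pt p.1 p.2) i)⁻¹) =O[stepFilter P t]
        fun _ => (1 : ℝ) := by
      refine IsBigO.of_bound c (eventually_stepFilter_of_forall fun p hp => ?_)
      simpa using hc _ ((pt_le_succ _ _).trans hp)
    simpa using h1.mul (hS.inc_isBigO i t)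
  have hlog := hasDerivAt_iff_isLittleO_nhds_zero.1 (Real.hasDerivAt_log one_ne_zero)
  refine ((hlog.comp_tendsto (hu.trans_tendsto (hS.tendsto_rootControl t))).trans_isBigO
    hu).congr_left fun p => ?_
  have h0 := (hpos (P.pt p.1 p.2) i).ne'
  have h1 := (hpos (P.pt p.1 (p.2 + 1)) i).ne'
  have e : 1 + (S (P.pt p.1 p.2) i)⁻¹ * inc P (fun t => S t i) p =
      S (P.pt p.1 (p.2 + 1)) i / S (P.pt p.1 p.2) i := by
    simp only [inc]; field_simp; ring
  simp only [Function.comp_apply, e, Real.log_one, Real.log_div h1 h0]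
  simp only [inc, smul_eq_mul]
  ring

/-- The added half quadratic variation has increments O(control), which do not affect quadratic
variations. -/
theorem InQVd.itoLogVec (hS : InQVd P S) (hpos : ∀ t i, 0 < S t i) :
    InQVd P (itoLogVec P S) := by
  have hL := hS.log hpos
  have hLi := fun i => hL.inQV i
  refine hL.of_inc_sub_mul (h := fun _ _ => 1) continuous_const
    (continuous_pi fun i => (hLi i).continuous.add
      ((hLi i).continuous_quadVar.const_mul (1 / 2))) fun i t => ?_
  refine (((hL.quadVar_inc_isBigO i t).const_mul_left (1 / 2)).trans_isLittleO
    (hL.control_isLittleO t)).congr_left fun p => ?_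
  simp only [inc, PathwiseIto.itoLogVec, itoLog]
  ring

end Logarithms

/-! ### Admissibility of the integrands. -/

section Admissible

variable {P : RefiningPartitions} {d : ℕ} {X : ℝ≥0 → Fin d → ℝ}

theorem InQVd.boundedVariationOn_bracketVec (hX : InQVd P X) (T : ℝ≥0) :
    BoundedVariationOn (bracketVec P X) (Set.Icc 0 T) := by
  have hK : BoundedVariationOn (totalVar P X) (Set.Icc 0 T) := by
    have h := (hX.totalVar_mono.monotoneOn (Set.Icc 0 T)).locallyBoundedVariationOn 0 T
      ⟨le_rfl, zero_le⟩ ⟨zero_le, le_rfl⟩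
    rwa [Set.inter_self] at h
  refine ne_top_of_le_ne_top hK (iSup_mono fun p => Finset.sum_le_sum fun k _ => ?_)
  have hle := p.2.2.1 (Nat.le_succ k)
  have hK0 := sub_nonneg.2 (hX.totalVar_mono hle)
  rw [edist_dist, edist_dist]
  refine ENNReal.ofReal_le_ofReal ?_
  rw [Real.dist_eq, abs_of_nonneg hK0, dist_pi_le_iff hK0]
  exact fun b => hX.abs_bracket_sub_le _ _ hle

theorem isAdmissibleIntegrand_const (hX : InQVd P X) (w : Fin d → ℝ) :
    IsAdmissibleIntegrand P X fun _ => w := by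
  -- A constant is the gradient of a linear function, with no auxiliary variable (`m = 0`).
  refine ⟨hX, fun T _ => ⟨0, Set.univ, Set.univ, fun x _ => ∑ i, w i * x i, fun _ => 0,
    isOpen_univ, isOpen_univ, isC21On_of_contDiff (by fun_prop),
    ⟨continuousOn_const, ?_, fun _ _ => trivial⟩, fun t _ => ⟨trivial, ?_⟩⟩⟩
  · have h : eVariationOn (fun _ : ℝ≥0 => (0 : Fin 0 → ℝ)) (Set.Icc 0 T) = 0 :=
      eVariationOn.constant_on (Set.subsingleton_of_subsingleton)
    rw [BoundedVariationOn, h]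
    exact ENNReal.zero_ne_top
  · funext i
    let ℓ : (Fin d → ℝ) →L[ℝ] ℝ :=
      ∑ j, w j • (ContinuousLinearMap.proj (R := ℝ) (φ := fun _ : Fin d => ℝ) j)
    have e : (fun y : Fin d → ℝ => ∑ i, w i * y i) = ℓ := by funext y; simp [ℓ]
    rw [gradX, e, ℓ.fderiv]
    simp [ℓ, Pi.single_apply]

variable (μ : Measure (stdSimplex ℝ (Fin d))) [IsProbabilityMeasure μ]

theorem InQVd.isAdmissibleIntegrand_tiltedMean (hX : InQVd P X) :
    IsAdmissibleIntegrand P X (tiltedMean P X μ) :=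
  ⟨hX, fun T _ => ⟨d * d, Set.univ, Set.univ,
    fun x a => logPartition μ (exponent (x - X 0) a), bracketVec P X, isOpen_univ, isOpen_univ,
    isC21On_logPartition_exponent μ (X 0),
    ⟨hX.continuous_bracketVec.continuousOn, hX.boundedVariationOn_bracketVec T,
      fun _ _ => trivial⟩,
    fun t _ => ⟨trivial, funext fun i =>
      (gradX_logPartition_exponent μ (X 0) (X t) (bracketVec P X t) i).symm⟩⟩⟩

end Admissible

/-! ### Identification of the universal portfolio. -/

section UniversalPortfolio

variable {P : RefiningPartitions} {d : ℕ} {S : ℝ≥0 → Fin d → ℝ}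

theorem portfolioValue_constRebalanced (hM : InQVd P (itoLogVec P S))
    (π : stdSimplex ℝ (Fin d)) (t : ℝ≥0) :
    portfolioValue P S (constRebalanced π) t = Real.exp (logValue P (itoLogVec P S) t π) :=
  hM.ddExp_follmerIntegral_const π t

variable (μ : Measure (stdSimplex ℝ (Fin d)))

theorem averageValue_eq (hM : InQVd P (itoLogVec P S)) (t : ℝ≥0) :
    averageValue P S μ t = ∫ π, Real.exp (logValue P (itoLogVec P S) t π) ∂μ := by
  simp only [averageValue, portfolioValue_constRebalanced hM]

/-- V^π_t / V̂_t is exactly the density of the tilted measure at time `t`. -/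
theorem universalPortfolio_eq_tiltedMean (hM : InQVd P (itoLogVec P S)) :
    universalPortfolio P S μ = tiltedMean P (itoLogVec P S) μ := by
  funext t i
  rw [universalPortfolio, averageValue_eq μ hM, tiltedMean, integral_tilted, ← integral_div]
  refine integral_congr_ae (Eventually.of_forall fun π => ?_)
  simp only [portfolioValue_constRebalanced hM, smul_eq_mul]
  ring

end UniversalPortfolio

end PathwiseIto

end

theorem theorem3p1 (P : RefiningPartitions) (d : ℕ) (S : ℝ≥0 → Fin d → ℝ)
    (hS : InQVd P S) (hpos : ∀ t i, 0 < S t i)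
    (μ : Measure (stdSimplex ℝ (Fin d))) [IsProbabilityMeasure μ] :
    -- the Itô logarithm of the prices, all `V^π` with constant `π`, and both averages
    -- are well defined
    (∀ i, InQV P fun t => Real.log (S t i)) ∧
    (∀ π : stdSimplex ℝ (Fin d),
      IsPortfolioStrategy P S (constRebalanced π) ∧
      ValueProcessExists P S (constRebalanced π)) ∧
    (∀ t, Integrable (fun π => portfolioValue P S (constRebalanced π) t) μ) ∧
    (∀ t i, Integrable
      (fun π : stdSimplex ℝ (Fin d) =>
        (π : Fin d → ℝ) i * portfolioValue P S (constRebalanced π) t) μ) ∧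
    (∀ t, 0 < averageValue P S μ t) ∧
    -- `π̂` is a portfolio strategy, and its portfolio value process is `V̂`
    IsPortfolioStrategy P S (universalPortfolio P S μ) ∧
    ValueProcessExists P S (universalPortfolio P S μ) ∧
    (∀ t, portfolioValue P S (universalPortfolio P S μ) t = averageValue P S μ t) := by
  have hM := hS.itoLogVec hpos
  have hw := universalPortfolio_eq_tiltedMean μ hM
  obtain ⟨hI, hqv, hval⟩ := hM.follmerIntegral_tiltedMean μ
  simp only [portfolioValue_constRebalanced hM, averageValue_eq μ hM, hw]
  refine ⟨(hS.log hpos).inQV, fun π => ⟨⟨fun _ => π.2, isAdmissibleIntegrand_const hM _⟩,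
    ⟨fun t => ⟨_, hM.tendsto_follmerSum_const _ t⟩, (hM.follmerIntegral_const_inQV _).1⟩⟩,
    fun t => integrable_exp μ _, fun t i => ?_, fun t => integral_exp_continuousMap_pos μ _,
    ⟨fun t => ?_, hM.isAdmissibleIntegrand_tiltedMean μ⟩, ⟨hI, hqv⟩, hval⟩
  · exact integrable_of_continuous μ ((continuous_coord i).mul
      (Real.continuous_exp.comp (logValue P (itoLogVec P S) t).continuous))
  · have := isProbabilityMeasure_tilted_continuousMap μ (logValue P (itoLogVec P S) t)
    exact integral_coord_mem_stdSimplex _
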